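/- **Setting.** Let $W\sim\mathcal P_W$ be a random parameter in a measurable space $\mathcal W$. Let $X^n=(X_1,\dots,X_n)$ be samples generated from $W$ through a Markov kernel $\mathcal P_{X^n|W}$. Let $Z^n$ be the privatised samples obtained from $X^n$ through the tensor power $K^{\otimes n}$ of a Markov kernel $K$ (given $X^n=x^n$, the $Z_i$ are independent with laws $K(\cdot|x_i)$). Let $\hat W\in\hat{\mathcal W}$ be any (possibly randomised) estimator computed from $Z^n$, with kernel $\mathcal P_{\hat W|Z^n}$, so that $W-X^n-Z^n-\hat W$ is a Markov chain. Let $\ell:\mathcal W\times\hat{\mathcal W}\to[0,\infty)$ be a measurable loss, and for $\rho>0$ put $$L_W(\hat W,\rho)=\mathcal P_W\mathcal P_{\hat W}\big(\ell(W,\hat W)<\rho\big),\qquad L_W(\rho)=\sup_{\hat w\in\hat{\mathcal W}}\mathcal P_W\big(\ell(W,\hat w)<\rho\big).$$ Let $\varphi:[0,\infty)\to\mathbb R$ be convex with $\varphi(1)=0$, and let $\varphi^\star(0)=\sup_{t\ge0}(-\varphi(t))$. For probability measures $\nu,\mu$ let $D_\varphi(\nu\|\mu)=\int q\,\varphi(p/q)$,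 with $p,q$ the densities of $\nu,\mu$ with respect to a common dominating measure and $q\,\varphi(p/q)=p\lim_{t\to\infty}\varphi(t)/t$ where $q=0$. Let $I_\varphi(W,X^n)=D_\varphi(\mathcal P_{WX^n}\|\mathcal P_W\mathcal P_{X^n})$, and define the contraction coefficients $$\eta_\varphi(\mu,K)=\sup_{\nu\ll\mu,\ \nu\ne\mu}\frac{D_\varphi(\nu K\|\mu K)}{D_\varphi(\nu\|\mu)},\qquad \eta_\varphi(K)=\sup_\mu\eta_\varphi(\mu,K),$$ the suprema being over probability measures (the ratios $0/0$, $a/\infty$, $\infty/\infty$ and the supremum of the empty set count as $0$). Put, with $0\cdot\infty=0$, $$J=\eta_\varphi(\mathcal P_{\hat W|Z^n})\,\eta_\varphi(\mathcal P_{X^n},K^{\otimes n})\,I_\varphi(W,X^n).$$ **(i)** Let $\varphi$ be non-decreasing, with generalised inverse $\varphi^{-1}(y)=\inf\{t\ge0:\varphi(t)>y\}\in[0,\infty]$, and assume that $G_\varphi(I,L)=L\,\varphi^{-1}(I/L)$ is non-decreasing in both $I\ge0$ and $L\in(0,1]$. Then for every $\rho>0$ $$\mathcal P_{W\hat W}(\ell(W,\hat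 W))\ \ge\ \rho\left(1-L\cdot\varphi^{-1}\!\left(\frac{J+(1-L)\varphi^\star(0)}{L}\right)\right)$$ both with $L=L_W(\hat W,\rho)$ and with $L=L_W(\rho)$, in each case provided that $L>0$. **(ii)** Let $\varphi$ be non-increasing, with generalised inverse $\varphi^{-1}(y)=\inf\{t\ge0:\varphi(t)\le y\}$. Then for every $\rho>0$ $$\mathcal P_{W\hat W}(\ell(W,\hat W))\ \ge\ \rho\,\big(1-L_W(\hat W,\rho)\big)\cdot\varphi^{-1}\!\left(\frac{J+L\,\varphi^\star(0)}{1-L}\right)$$ both with $L=L_W(\hat W,\rho)$ and with $L=L_W(\rho)$, in each case provided that $L<1$ and that $L\,\varphi^\star(0)$ is not of the form $0\cdot\infty$. Consequently $\mathcal P_{W\hat W}(\ell(W,\hat W))$ is at least the supremum of each of these right-hand sides over the admissible $\rho>0$. -/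

import Mathlib

open MeasureTheory ProbabilityTheory Set
open scoped NNReal ENNReal

noncomputable section

namespace PhiRisk

/-! ### Convex functions on `[0, ∞)`

A function `φ : [0, ∞) → ℝ` is represented by `φ : ℝ → ℝ`, of which only the values on `[0, ∞)` are
ever used. -/

/-- The recession slope `φ'(∞) = lim_{t → ∞} φ(t) / t ∈ (-∞, ∞]`. For convex `φ` the slopes
`(φ(t) - φ(0)) / t` are non-decreasing in `t`, so that their supremum is this limit. -/
def recessionSlope (φ : ℝ → ℝ) : EReal :=
  ⨆ (t : ℝ) (_ : 0 < t), (((φ t - φ 0) / t : ℝ) : EReal)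

/-- The Legendre-Fenchel dual `φ⋆(y) = sup_{t ≥ 0} (t y - φ(t))`. -/
def conjugate (φ : ℝ → ℝ) (y : ℝ) : EReal :=
  ⨆ (t : ℝ) (_ : 0 ≤ t), ((t * y - φ t : ℝ) : EReal)

/-- The generalised inverse `φ⁻¹(y) = inf {t ≥ 0 : φ(t) > y}` of a non-decreasing function
(`inf ∅ = +∞`). -/
def incInverse (φ : ℝ → ℝ) (y : EReal) : EReal :=
  ⨅ (t : ℝ) (_ : 0 ≤ t) (_ : y < (φ t : EReal)), (t : EReal)

/-- The generalised inverse `φ⁻¹(y) = inf {t ≥ 0 : φ(t) ≤ y}` of a non-increasing function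
(`inf ∅ = +∞`). -/
def decInverse (φ : ℝ → ℝ) (y : EReal) : EReal :=
  ⨅ (t : ℝ) (_ : 0 ≤ t) (_ : (φ t : EReal) ≤ y), (t : EReal)

/-- The functional `G_φ(I, L) = L φ⁻¹(I / L)`. -/
def G (φ : ℝ → ℝ) (I L : ℝ) : EReal :=
  (L : EReal) * incInverse φ ((I / L : ℝ) : EReal)

/-! ### Divergences and contraction coefficients -/

open Classical in
/-- The `φ`-divergence `D_φ(ν ‖ μ) = ∫ q φ(p / q)`, where `p, q` are the densities of `ν, μ` with
respect to any dominating measure, with the usual meaning `q φ(p / q) = p φ'(∞)` where `q = 0`: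
`D_φ(ν ‖ μ) = ∫ φ(dν/dμ) dμ + φ'(∞) ν^⊥(Ω)`, where `ν^⊥` is the part of `ν` singular to `μ`.
For `φ` convex the negative part of `φ(dν/dμ)` is always `μ`-integrable, so a
non-integrable `φ(dν/dμ)` has integral `+∞`. -/
def phiDiv {Ω : Type*} [MeasurableSpace Ω] (φ : ℝ → ℝ) (ν μ : Measure Ω) : EReal :=
  if Integrable (fun x => φ ((ν.rnDeriv μ x).toReal)) μ then
    ((∫ x, φ ((ν.rnDeriv μ x).toReal) ∂μ : ℝ) : EReal)
      + recessionSlope φ * ((ν.singularPart μ univ : ℝ≥0∞) : EReal)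
  else ⊤

/-- The `φ`-mutual information `D_φ(P_{XY} ‖ P_X P_Y)` of a joint law `P_{XY}`. -/
def phiMutualInfo {𝓧 𝓨 : Type*} [MeasurableSpace 𝓧] [MeasurableSpace 𝓨] (φ : ℝ → ℝ)
    (P : Measure (𝓧 × 𝓨)) : EReal :=
  phiDiv φ P (P.fst.prod P.snd)

/-- The contraction coefficient `η_φ(μ, K) = sup_{ν ≪ μ, ν ≠ μ} D_φ(νK ‖ μK) / D_φ(ν ‖ μ)`, the
supremum being over probability measures `ν`. Both divergences are non-negative when `φ(1) = 0`;
ratios `0 / 0`, `a / ∞` and `∞ / ∞` count as `0`, and so does the supremum of the empty set. -/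
def eta {𝓧 𝓨 : Type*} [MeasurableSpace 𝓧] [MeasurableSpace 𝓨] (φ : ℝ → ℝ)
    (μ : Measure 𝓧) (K : Kernel 𝓧 𝓨) : ℝ≥0∞ :=
  ⨆ (ν : Measure 𝓧) (_ : IsProbabilityMeasure ν) (_ : ν ≪ μ) (_ : ν ≠ μ),
    (phiDiv φ (K ∘ₘ ν) (K ∘ₘ μ)).toENNReal / (phiDiv φ ν μ).toENNReal

/-- The contraction coefficient `η_φ(K) = sup_μ η_φ(μ, K)` over probability measures `μ`. -/
def etaSup {𝓧 𝓨 : Type*} [MeasurableSpace 𝓧] [MeasurableSpace 𝓨] (φ : ℝ → ℝ)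
    (K : Kernel 𝓧 𝓨) : ℝ≥0∞ :=
  ⨆ (μ : Measure 𝓧) (_ : IsProbabilityMeasure μ), eta φ μ K

/-! ### Tensor powers of a Markov kernel -/

lemma measurable_pi_kernel {𝓧 𝓩 : Type*} [MeasurableSpace 𝓧] [MeasurableSpace 𝓩]
    (K : Kernel 𝓧 𝓩) [IsMarkovKernel K] (n : ℕ) :
    Measurable (fun x : Fin n → 𝓧 => Measure.pi (fun i => K (x i))) := by
  refine Measurable.measure_of_isPiSystem_of_isProbabilityMeasure
    generateFrom_pi.symm isPiSystem_pi ?_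
  rintro _ ⟨s, hs, rfl⟩
  simp only [Measure.pi_pi]
  refine Finset.measurable_prod _ fun i _ => ?_
  exact (K.measurable_coe (hs i (mem_univ i))).comp (measurable_pi_apply i)

/-- The tensor power `K^{⊗n}`: given `(x₁, …, xₙ)`, the outputs are independent with laws
`K(x₁), …, K(xₙ)`. -/
def tensorPower {𝓧 𝓩 : Type*} [MeasurableSpace 𝓧] [MeasurableSpace 𝓩]
    (K : Kernel 𝓧 𝓩) [IsMarkovKernel K] (n : ℕ) : Kernel (Fin n → 𝓧) (Fin n → 𝓩) where
  toFun x := Measure.pi (fun i => K (x i))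
  measurable' := measurable_pi_kernel K n

/-! ### The Bayesian framework with privatised samples -/

section Framework

variable {𝓦 𝓥 𝓧 𝓩 : Type*} [MeasurableSpace 𝓦] [MeasurableSpace 𝓥] [MeasurableSpace 𝓧]
  [MeasurableSpace 𝓩] {n : ℕ}

/-- The joint law of `(W, Xⁿ)` for the prior `π` and the observation model `P_{Xⁿ|W} = P`. -/
def jointWX (π : Measure 𝓦) (P : Kernel 𝓦 (Fin n → 𝓧)) : Measure (𝓦 × (Fin n → 𝓧)) :=
  π ⊗ₘ P

/-- The joint law of `(W, Ŵ)` in the Markov chain `W - Xⁿ - Zⁿ - Ŵ`, where `Zⁿ` is obtained from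
`Xⁿ` through `K^{⊗n}` and `Ŵ` from `Zⁿ` through the estimator `P_{Ŵ|Zⁿ} = E`. -/
def jointWEst (π : Measure 𝓦) (P : Kernel 𝓦 (Fin n → 𝓧)) (K : Kernel 𝓧 𝓩) [IsMarkovKernel K]
    (E : Kernel (Fin n → 𝓩) 𝓥) : Measure (𝓦 × 𝓥) :=
  π ⊗ₘ (E ∘ₖ (tensorPower K n ∘ₖ P))

/-- The expected loss `P_{WŴ}(ℓ(W, Ŵ))` under a joint law of `(W, Ŵ)`. -/
def risk (ℓ : 𝓦 → 𝓥 → ℝ≥0) (Q : Measure (𝓦 × 𝓥)) : ℝ≥0∞ :=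
  ∫⁻ p, (ℓ p.1 p.2 : ℝ≥0∞) ∂Q

/-- `L_W(Ŵ, ρ) = P_W P_Ŵ (ℓ(W, Ŵ) < ρ)`, for a joint law of `(W, Ŵ)`. -/
def ballProb (ℓ : 𝓦 → 𝓥 → ℝ≥0) (Q : Measure (𝓦 × 𝓥)) (ρ : ℝ) : ℝ :=
  (Q.fst.prod Q.snd).real {p | (ℓ p.1 p.2 : ℝ) < ρ}

/-- The small-ball probability `L_W(ρ) = sup_ŵ P_W (ℓ(W, ŵ) < ρ)`. -/
def smallBallProb (ℓ : 𝓦 → 𝓥 → ℝ≥0) (π : Measure 𝓦) (ρ : ℝ) : ℝ :=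
  ⨆ v : 𝓥, π.real {w | (ℓ w v : ℝ) < ρ}

/-- `η_φ(P_{Ŵ|Zⁿ}) · η_φ(P_{Xⁿ}, K^{⊗n}) · I_φ(W, Xⁿ)`. -/
def contractedInfo (φ : ℝ → ℝ) (π : Measure 𝓦) (P : Kernel 𝓦 (Fin n → 𝓧)) (K : Kernel 𝓧 𝓩)
    [IsMarkovKernel K] (E : Kernel (Fin n → 𝓩) 𝓥) : EReal :=
  (etaSup φ E : EReal) * (eta φ (P ∘ₘ π) (tensorPower K n) : EReal)
    * phiMutualInfo φ (jointWX π P)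

end Framework

/-- `φ⁻¹((I + (1 - L) φ⋆(0)) / L)`, for non-decreasing `φ`. -/
def incTerm (φ : ℝ → ℝ) (I : EReal) (L : ℝ) : EReal :=
  incInverse φ ((I + ((1 - L : ℝ) : EReal) * conjugate φ 0) / (L : EReal))

/-- `φ⁻¹((I + L φ⋆(0)) / (1 - L))`, for non-increasing `φ`. -/
def decTerm (φ : ℝ → ℝ) (I : EReal) (L : ℝ) : EReal :=
  decInverse φ ((I + (L : EReal) * conjugate φ 0) / ((1 - L : ℝ) : EReal))

end PhiRisk

end

/-!
Quantise `W` to finitely many values. Each conditional law given a value of the quantised parameter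
is then dominated by a multiple of the mixture, so the `D_φ`-mutual information splits as an average
of divergences from the mixture, and contracting every term shows that it shrinks by
`η_φ(P_{Xⁿ}, T)` through the channel `T` and again by `η_φ(E)` through the estimator `E`. Data
processing on the indicator of an event `A` now compares the probabilities of `A` under `P_{WŴ}` and
under `P_W P_Ŵ`. It holds when `A` depends on `W` only through a quantisation; such events form an
algebra generating the product `σ`-algebra and the comparison is a closed condition on the two
probabilities, so it extends to `{ℓ < ρ}`. Markov's inequality then bounds the risk from below.
-/

noncomputable section

namespace PhiRisk

open Filter
open scoped symmDiff Topology

section Convex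

variable {φ : ℝ → ℝ}

lemma convexOn_closure {E : Type*} [AddCommGroup E] [Module ℝ E] [TopologicalSpace E]
    [IsTopologicalAddGroup E] [ContinuousSMul ℝ E] {s : Set E} {f : E → ℝ}
    (hf : ConvexOn ℝ s f) (hc : Continuous f) : ConvexOn ℝ (closure s) f := by
  refine ⟨hf.1.closure, fun x hx y hy a b ha hb hab => ?_⟩
  have hclosed : IsClosed {p : E × E | f (a • p.1 + b • p.2) ≤ a • f p.1 + b • f p.2} :=
    isClosed_le (by fun_prop) (by fun_prop)
  have hsub : s ×ˢ s ⊆ {p : E × E | f (a • p.1 + b • p.2) ≤ a • f p.1 + b • f p.2} :=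
    fun p hp => hf.2 hp.1 hp.2 ha hb hab
  have hmem : (x, y) ∈ closure (s ×ˢ s) := by
    rw [closure_prod_eq]
    exact mk_mem_prod hx hy
  exact closure_minimal hsub hclosed hmem

lemma exists_tendsto_nhdsGT_zero_of_convexOn (hφ : ConvexOn ℝ (Ici 0) φ) :
    ∃ l ≤ φ 0, Tendsto φ (𝓝[>] 0) (𝓝 l) := by
  have hslope := hφ.slope_mono (x := 1) (by simp)
  have hmem : ∀ {t : ℝ}, 0 ≤ t → min t 2⁻¹ ∈ Ici (0 : ℝ) \ {1} := fun ht =>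
    ⟨le_min ht (by norm_num), ((min_le_right _ _).trans_lt (by norm_num)).ne⟩
  have hmono : MonotoneOn (fun t => slope φ 1 (min t 2⁻¹)) (Ioi 0) := fun s hs t ht hst =>
    hslope (hmem (le_of_lt hs)) (hmem (le_of_lt ht)) (min_le_min_right _ hst)
  have hbdd : BddBelow ((fun t => slope φ 1 (min t 2⁻¹)) '' Ioi 0) := by
    refine ⟨slope φ 1 0, ?_⟩
    rintro _ ⟨t, ht, rfl⟩
    exact hslope (by simp) (hmem (le_of_lt ht)) (le_min (le_of_lt ht) (by norm_num))
  have hsmall : ∀ᶠ t : ℝ in 𝓝[>] 0, φ 1 + slope φ 1 (min t 2⁻¹) * (t - 1) = φ t := by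
    filter_upwards [Ioo_mem_nhdsGT (show (0 : ℝ) < 2⁻¹ by norm_num)] with t ht
    have := sub_smul_slope φ 1 t
    rw [min_eq_left ht.2.le]
    simp only [smul_eq_mul, vsub_eq_sub] at this
    linarith
  have hlim := ((hmono.tendsto_nhdsGT hbdd).mul
    ((tendsto_id.mono_left nhdsWithin_le_nhds).sub_const 1)).const_add (φ 1) |>.congr' hsmall
  refine ⟨_, ?_, hlim⟩
  refine le_of_tendsto_of_tendsto hlim
    (tendsto_const_nhds.add ((tendsto_id.mono_left nhdsWithin_le_nhds).mul_const (φ 1 - φ 0)))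
    ?_ |>.trans_eq (by simp : φ 0 + 0 * (φ 1 - φ 0) = φ 0)
  filter_upwards [Ioo_mem_nhdsGT one_pos] with t ht
  have := hφ.2 (show (0 : ℝ) ∈ Ici 0 by simp) (show (1 : ℝ) ∈ Ici 0 by simp)
    (sub_nonneg.mpr ht.2.le) ht.1.le (by ring)
  simp only [smul_eq_mul, mul_zero, mul_one, zero_add] at this
  simp only [id]
  linarith

lemma exists_continuous_add_indicator_of_convexOn (hφ : ConvexOn ℝ (Ici 0) φ) :
    ∃ ψ : ℝ → ℝ, ∃ a, Continuous ψ ∧ ConvexOn ℝ (Ici 0) ψ ∧ 0 ≤ a ∧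
      EqOn φ (fun t => ψ t + ({0} : Set ℝ).indicator (fun _ => a) t) (Ici 0) := by
  obtain ⟨l, hl, hlim⟩ := exists_tendsto_nhdsGT_zero_of_convexOn hφ
  set ψ : ℝ → ℝ := (Ioi 0).piecewise φ fun _ => l with hψ
  have heq : EqOn ψ φ (Ioi 0) := piecewise_eqOn _ _ _
  have hconst : ∀ t ≤ 0, ψ t = l := fun t ht => piecewise_eq_of_notMem _ _ _ (not_lt.mpr ht)
  have hconvex : ConvexOn ℝ (Ioi 0) ψ :=
    (hφ.subset Ioi_subset_Ici_self (convex_Ioi 0)).congr heq.symm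
  have hcont : Continuous ψ := by
    refine continuous_iff_continuousAt.mpr fun t => ?_
    rcases lt_trichotomy t 0 with ht | rfl | ht
    · refine continuousAt_const (y := l) |>.congr ?_
      filter_upwards [Iio_mem_nhds ht] with s hs using (hconst s (le_of_lt hs)).symm
    · refine continuousAt_iff_continuous_left'_right'.mpr ⟨?_, ?_⟩ <;>
        rw [ContinuousWithinAt, hconst 0 le_rfl]
      · refine tendsto_const_nhds.congr' ?_
        filter_upwards [self_mem_nhdsWithin] with s hs using (hconst s (le_of_lt hs)).symm
      · refine hlim.congr' ?_
        filter_upwards [self_mem_nhdsWithin] with s hs using (heq hs).symm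
    · have := (interior_Ici (a := (0 : ℝ)) ▸ hφ.continuousOn_interior).continuousAt
        (Ioi_mem_nhds ht)
      exact this.congr (heq.eventuallyEq_of_mem (Ioi_mem_nhds ht)).symm
  refine ⟨ψ, φ 0 - l, hcont, closure_Ioi (0 : ℝ) ▸ convexOn_closure hconvex hcont,
    sub_nonneg.mpr hl, fun t ht => ?_⟩
  rcases (mem_Ici.mp ht).eq_or_lt with rfl | ht
  · simp [hψ]
  · simp [heq ht, ht.ne']

lemma exists_affine_le_of_convexOn (hφ : ConvexOn ℝ (Ici 0) φ) :
    ∃ b c, ∀ t, 0 ≤ t → b * t + c ≤ φ t := by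
  obtain ⟨ψ, a, hψc, hψ, ha, hφψ⟩ := exists_continuous_add_indicator_of_convexOn hφ
  obtain ⟨b, c, h⟩ := hψ.exists_affine_le_real isClosed_Ici hψc.continuousOn.lowerSemicontinuousOn
  refine ⟨b, c, fun t ht => ?_⟩
  rw [hφψ ht]
  exact (h t ht).trans (le_add_of_nonneg_right (indicator_nonneg (fun _ _ => ha) t))

lemma measurable_comp_of_convexOn {Ω : Type*} [MeasurableSpace Ω] (hφ : ConvexOn ℝ (Ici 0) φ)
    {f : Ω → ℝ} (hf : Measurable f) (hf0 : ∀ x, 0 ≤ f x) : Measurable fun x => φ (f x) := by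
  obtain ⟨ψ, a, hψ, -, -, hφψ⟩ := exists_continuous_add_indicator_of_convexOn hφ
  rw [funext fun x => hφψ (hf0 x)]
  exact (hψ.measurable.comp hf).add
    ((measurable_const.indicator (measurableSet_singleton 0)).comp hf)

lemma apply_sub_le_mul_of_recessionSlope_le {M t : ℝ} (hM : recessionSlope φ ≤ M) (ht : 0 ≤ t) :
    φ t - φ 0 ≤ M * t := by
  rcases ht.eq_or_lt with rfl | ht
  · simp
  · rw [← div_le_iff₀ ht]
    exact_mod_cast (le_iSup₂_of_le (f := fun (t : ℝ) (_ : 0 < t) =>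
      (((φ t - φ 0) / t : ℝ) : EReal)) t ht le_rfl).trans hM

lemma apply_add_le_of_recessionSlope_le (hφ : ConvexOn ℝ (Ici 0) φ) {M p r : ℝ}
    (hM : recessionSlope φ ≤ M) (hp : 0 ≤ p) (hr : 0 ≤ r) : φ (p + r) ≤ φ p + M * r := by
  rcases hr.eq_or_lt with rfl | hr
  · simp
  have hbound : ∀ᶠ s in atTop, φ (p + r) - φ p ≤ r * (M + (φ 0 + M * p - φ p) / s) := by
    filter_upwards [eventually_ge_atTop r, eventually_gt_atTop 0] with s hrs hs
    have hslope := hφ.secant_mono (a := p) (x := p + r) (y := p + s) hp (add_nonneg hp hr.le)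
      (add_nonneg hp hs.le) (by simp [hr.ne']) (by simp [hs.ne']) (by linarith)
    have hrec := apply_sub_le_mul_of_recessionSlope_le hM (add_nonneg hp hs.le)
    rw [add_sub_cancel_left, add_sub_cancel_left, div_le_iff₀ hr] at hslope
    calc φ (p + r) - φ p ≤ (φ (p + s) - φ p) / s * r := hslope
      _ ≤ (M * (p + s) + φ 0 - φ p) / s * r := by gcongr; linarith
      _ = r * (M + (φ 0 + M * p - φ p) / s) := by field_simp; ring
  have hlim : Tendsto (fun s : ℝ => r * (M + (φ 0 + M * p - φ p) / s)) atTop (𝓝 (r * (M + 0))) :=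
    ((tendsto_const_nhds.div_atTop tendsto_id).const_add M).const_mul r
  linarith [ge_of_tendsto hlim hbound]

end Convex

section Divergence

variable {Ω : Type*} [MeasurableSpace Ω] {φ : ℝ → ℝ} {Q R μ : Measure Ω}

lemma phiDiv_of_integrable (h : Integrable (fun x => φ (Q.rnDeriv μ x).toReal) μ) :
    phiDiv φ Q μ = ((∫ x, φ (Q.rnDeriv μ x).toReal ∂μ : ℝ) : EReal)
      + recessionSlope φ * ((Q.singularPart μ univ : ℝ≥0∞) : EReal) :=
  if_pos h

lemma phiDiv_of_not_integrable (h : ¬ Integrable (fun x => φ (Q.rnDeriv μ x).toReal) μ) :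
    phiDiv φ Q μ = ⊤ :=
  if_neg h

lemma phiDiv_of_absolutelyContinuous (hac : Q ≪ μ)
    (h : Integrable (fun x => φ (Q.rnDeriv μ x).toReal) μ) :
    phiDiv φ Q μ = ((∫ x, φ (Q.rnDeriv μ x).toReal ∂μ : ℝ) : EReal) := by
  simp [phiDiv_of_integrable h, Measure.singularPart_eq_zero_of_ac hac]

lemma bot_lt_recessionSlope (φ : ℝ → ℝ) : ⊥ < recessionSlope φ :=
  (EReal.bot_lt_coe _).trans_le (le_iSup₂_of_le (f := fun (t : ℝ) (_ : 0 < t) =>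
    (((φ t - φ 0) / t : ℝ) : EReal)) 1 one_pos le_rfl)

lemma coe_mul_measure_univ (M : ℝ) (μ : Measure Ω) [IsFiniteMeasure μ] :
    (M : EReal) * ((μ univ : ℝ≥0∞) : EReal) = ((M * μ.real univ : ℝ) : EReal) := by
  rw [EReal.coe_mul, Measure.real, EReal.coe_ennreal_toReal (measure_ne_top _ _)]

lemma recessionSlope_mul_measure_ne_bot (φ : ℝ → ℝ) (μ : Measure Ω) [IsFiniteMeasure μ] :
    recessionSlope φ * ((μ univ : ℝ≥0∞) : EReal) ≠ ⊥ := by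
  induction h : recessionSlope φ with
  | bot => exact absurd h (bot_lt_recessionSlope φ).ne'
  | coe M => exact coe_mul_measure_univ M μ ▸ EReal.coe_ne_bot _
  | top => exact (EReal.bot_lt_zero.trans_le (EReal.mul_nonneg le_top
      (EReal.coe_ennreal_nonneg _))).ne'

lemma phiDiv_ne_bot (φ : ℝ → ℝ) (Q μ : Measure Ω) [IsFiniteMeasure Q] : phiDiv φ Q μ ≠ ⊥ := by
  by_cases h : Integrable (fun x => φ (Q.rnDeriv μ x).toReal) μ
  · rw [phiDiv_of_integrable h]
    exact EReal.add_ne_bot_iff.mpr ⟨EReal.coe_ne_bot _, recessionSlope_mul_measure_ne_bot φ _⟩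
  · simp [phiDiv_of_not_integrable h]

lemma phiDiv_eq_withDensity_add (φ : ℝ → ℝ) (Q μ : Measure Ω) [IsFiniteMeasure Q] [SigmaFinite μ] :
    phiDiv φ Q μ = phiDiv φ (μ.withDensity (Q.rnDeriv μ)) μ
      + recessionSlope φ * ((Q.singularPart μ univ : ℝ≥0∞) : EReal) := by
  have hcongr : (fun x => φ ((μ.withDensity (Q.rnDeriv μ)).rnDeriv μ x).toReal)
      =ᵐ[μ] fun x => φ (Q.rnDeriv μ x).toReal := by
    filter_upwards [Measure.rnDeriv_withDensity μ (Measure.measurable_rnDeriv Q μ)] with x hx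
    rw [hx]
  by_cases h : Integrable (fun x => φ (Q.rnDeriv μ x).toReal) μ
  · rw [phiDiv_of_integrable h,
      phiDiv_of_absolutelyContinuous (withDensity_absolutelyContinuous _ _)
      ((integrable_congr hcongr).mpr h), integral_congr_ae hcongr]
  · rw [phiDiv_of_not_integrable h, phiDiv_of_not_integrable (mt (integrable_congr hcongr).mp h),
      EReal.top_add_of_ne_bot (recessionSlope_mul_measure_ne_bot φ _)]

lemma integrable_comp_of_le [IsFiniteMeasure μ] (hφ : ConvexOn ℝ (Ici 0) φ) {f g : Ω → ℝ}
    (hf : Measurable f) (hf0 : ∀ x, 0 ≤ f x) (hfi : Integrable f μ) (hg : Integrable g μ)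
    (hle : (fun x => φ (f x)) ≤ᵐ[μ] g) : Integrable (fun x => φ (f x)) μ := by
  obtain ⟨b, c, hbc⟩ := exists_affine_le_of_convexOn hφ
  exact integrable_of_le_of_le (measurable_comp_of_convexOn hφ hf hf0).aestronglyMeasurable
    (ae_of_all _ fun x => hbc _ (hf0 x)) hle ((hfi.const_mul b).add (integrable_const c)) hg

lemma phiDiv_add_le [IsFiniteMeasure Q] [IsFiniteMeasure R] [IsFiniteMeasure μ]
    (hφ : ConvexOn ℝ (Ici 0) φ) :
    phiDiv φ (Q + R) μ ≤ phiDiv φ Q μ + recessionSlope φ * ((R univ : ℝ≥0∞) : EReal) := by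
  rcases eq_or_ne R 0 with rfl | hR
  · simp
  induction hM : recessionSlope φ with
  | bot => exact absurd hM (bot_lt_recessionSlope φ).ne'
  | top =>
    rw [EReal.top_mul_coe_ennreal (by simpa using hR),
      EReal.add_top_of_ne_bot (phiDiv_ne_bot φ Q μ)]
    exact le_top
  | coe M =>
    by_cases hQ : Integrable (fun x => φ (Q.rnDeriv μ x).toReal) μ
    swap
    · rw [phiDiv_of_not_integrable hQ, coe_mul_measure_univ, EReal.top_add_coe]
      exact le_top
    have hle : (fun x => φ ((Q + R).rnDeriv μ x).toReal)
        ≤ᵐ[μ] fun x => φ (Q.rnDeriv μ x).toReal + M * (R.rnDeriv μ x).toReal := by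
      filter_upwards [Measure.rnDeriv_add' Q R μ, Measure.rnDeriv_ne_top Q μ,
        Measure.rnDeriv_ne_top R μ] with x hx hQx hRx
      rw [hx, Pi.add_apply, ENNReal.toReal_add hQx hRx]
      exact apply_add_le_of_recessionSlope_le hφ hM.le ENNReal.toReal_nonneg ENNReal.toReal_nonneg
    have hbound := hQ.add (Measure.integrable_toReal_rnDeriv (μ := R) (ν := μ) |>.const_mul M)
    have hQR := integrable_comp_of_le hφ (Measure.measurable_rnDeriv (Q + R) μ).ennreal_toReal
      (fun _ => ENNReal.toReal_nonneg) Measure.integrable_toReal_rnDeriv hbound hle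
    have hint := integral_mono_ae hQR hbound hle
    rw [Pi.add_def, integral_add hQ (Measure.integrable_toReal_rnDeriv.const_mul M),
      integral_const_mul, Measure.integral_toReal_rnDeriv'] at hint
    rw [phiDiv_of_integrable hQR, phiDiv_of_integrable hQ, hM, coe_mul_measure_univ,
      coe_mul_measure_univ, coe_mul_measure_univ]
    norm_cast
    rw [Measure.singularPart_add, measureReal_add_apply]
    linarith

end Divergence

lemma integrable_indicator_singleton_comp {Ω : Type*} [MeasurableSpace Ω] {μ : Measure Ω}
    [IsFiniteMeasure μ] (z a : ℝ) {u : Ω → ℝ} (hu : Measurable u) :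
    Integrable (fun x => ({z} : Set ℝ).indicator (fun _ => a) (u x)) μ :=
  .of_bound ((measurable_const.indicator (measurableSet_singleton z)).comp hu).aestronglyMeasurable
    ‖a‖ (ae_of_all _ fun _ => norm_indicator_le_norm_self _ _)

section DataProcessing

variable {Ω Ω' : Type*} [MeasurableSpace Ω] [MeasurableSpace Ω'] {φ : ℝ → ℝ} {Q μ : Measure Ω}
  [IsFiniteMeasure Q] [IsFiniteMeasure μ] {g : Ω → Ω'}

lemma rnDeriv_eq_zero_of_rnDeriv_map_eq_zero (hac : Q ≪ μ) (hg : Measurable g) :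
    ∀ᵐ x ∂μ, (Q.map g).rnDeriv (μ.map g) (g x) = 0 → Q.rnDeriv μ x = 0 := by
  have hZ : MeasurableSet {y | (Q.map g).rnDeriv (μ.map g) y = 0} :=
    Measure.measurable_rnDeriv _ _ (measurableSet_singleton 0)
  have hnull : Q (g ⁻¹' {y | (Q.map g).rnDeriv (μ.map g) y = 0}) = 0 := by
    rw [← Measure.map_apply hg hZ, ← Measure.setLIntegral_rnDeriv (hac.map hg),
      setLIntegral_congr_fun (g := fun _ => 0) hZ fun y hy => hy, lintegral_zero]
  rw [← Measure.setLIntegral_rnDeriv hac, lintegral_eq_zero_iff (Measure.measurable_rnDeriv Q μ)]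
    at hnull
  exact (ae_restrict_iff' (hg hZ)).mp hnull

lemma integral_comp_rnDeriv_map_le (hφ : ConvexOn ℝ (Ici 0) φ) (hac : Q ≪ μ) (hg : Measurable g)
    (hint : Integrable (fun x => φ (Q.rnDeriv μ x).toReal) μ) :
    Integrable (fun y => φ ((Q.map g).rnDeriv (μ.map g) y).toReal) (μ.map g) ∧
      ∫ y, φ ((Q.map g).rnDeriv (μ.map g) y).toReal ∂(μ.map g)
        ≤ ∫ x, φ (Q.rnDeriv μ x).toReal ∂μ := by
  obtain ⟨ψ, a, hψc, hψ, ha, hφψ⟩ := exists_continuous_add_indicator_of_convexOn hφ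
  have hdecomp (u : ℝ≥0∞) :
      φ u.toReal = ψ u.toReal + ({0} : Set ℝ).indicator (fun _ => a) u.toReal :=
    hφψ ENNReal.toReal_nonneg
  have hQ := integrable_indicator_singleton_comp (μ := μ) 0 a
    (Measure.measurable_rnDeriv Q μ).ennreal_toReal
  have hmap := integrable_indicator_singleton_comp (μ := μ.map g) 0 a
    (Measure.measurable_rnDeriv (Q.map g) (μ.map g)).ennreal_toReal
  simp only [hdecomp] at hint ⊢
  have hψint : Integrable (fun x => ψ (Q.rnDeriv μ x).toReal) μ :=
    (hint.sub hQ).congr (ae_of_all _ fun _ => add_sub_cancel_right _ _)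
  have hψmap := hψ.integrable_comp_rnDeriv_map hac hg hψc.stronglyMeasurable
    hψc.continuousWithinAt hψint
  refine ⟨hψmap.add hmap, ?_⟩
  rw [integral_add hψmap hmap, integral_add hψint hQ]
  gcongr ?_ + ?_
  · rw [integral_map hg.aemeasurable hψmap.aestronglyMeasurable,
      ← integral_condExp (f := fun x => ψ (Q.rnDeriv μ x).toReal) hg.comap_le]
    exact integral_mono_ae (hψmap.comp_measurable hg) integrable_condExp
      (hψ.comp_rnDeriv_map_le hac hg hψc.stronglyMeasurable hψc.continuousWithinAt hψint)
  · rw [integral_map hg.aemeasurable hmap.aestronglyMeasurable]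
    refine integral_mono_ae (hmap.comp_measurable hg) hQ ?_
    filter_upwards [rnDeriv_eq_zero_of_rnDeriv_map_eq_zero hac hg,
      hg.quasiMeasurePreserving μ |>.ae (Measure.rnDeriv_ne_top (Q.map g) (μ.map g))] with x hx htop
    by_cases h : (Q.map g).rnDeriv (μ.map g) (g x) = 0
    · simp [h, hx h]
    · rw [indicator_of_notMem (by simpa [ENNReal.toReal_eq_zero_iff, h] using htop)]
      exact indicator_nonneg (fun _ _ => ha) _

lemma phiDiv_map_le (hφ : ConvexOn ℝ (Ici 0) φ) (hg : Measurable g) :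
    phiDiv φ (Q.map g) (μ.map g) ≤ phiDiv φ Q μ := by
  rw [phiDiv_eq_withDensity_add φ Q μ]
  set A := μ.withDensity (Q.rnDeriv μ)
  have hA : IsFiniteMeasure A := isFiniteMeasure_of_le Q (Measure.withDensity_rnDeriv_le Q μ)
  have hac : A ≪ μ := withDensity_absolutelyContinuous _ _
  have hAmap : phiDiv φ (A.map g) (μ.map g) ≤ phiDiv φ A μ := by
    by_cases hint : Integrable (fun x => φ (A.rnDeriv μ x).toReal) μ
    · obtain ⟨hmap, hle⟩ := integral_comp_rnDeriv_map_le hφ hac hg hint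
      rw [phiDiv_of_absolutelyContinuous hac hint,
        phiDiv_of_absolutelyContinuous (hac.map hg) hmap]
      exact_mod_cast hle
    · exact phiDiv_of_not_integrable hint ▸ le_top
  have hsplit : Q.map g = A.map g + (Q.singularPart μ).map g := by
    rw [← Measure.map_add _ _ hg, Q.rnDeriv_add_singularPart μ]
  calc phiDiv φ (Q.map g) (μ.map g)
      ≤ phiDiv φ (A.map g) (μ.map g)
        + recessionSlope φ * (((Q.singularPart μ).map g univ : ℝ≥0∞) : EReal) :=
        hsplit ▸ phiDiv_add_le hφ
    _ ≤ _ := by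
        rw [Measure.map_apply hg .univ, preimage_univ]
        gcongr

lemma phiDiv_comp_le {κ : Kernel Ω Ω'} [IsMarkovKernel κ] (hφ : ConvexOn ℝ (Ici 0) φ)
    (hac : Q ≪ μ) : phiDiv φ (κ ∘ₘ Q) (κ ∘ₘ μ) ≤ phiDiv φ Q μ := by
  by_cases hint : Integrable (fun x => φ (Q.rnDeriv μ x).toReal) μ
  swap
  · exact phiDiv_of_not_integrable hint ▸ le_top
  have hcongr : (fun p => φ ((Q ⊗ₘ κ).rnDeriv (μ ⊗ₘ κ) p).toReal)
      =ᵐ[μ ⊗ₘ κ] fun p => φ (Q.rnDeriv μ p.1).toReal := by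
    filter_upwards [rnDeriv_measure_compProd_left Q μ κ] with p hp using by rw [hp]
  have hmeas : AEStronglyMeasurable (fun x => φ (Q.rnDeriv μ x).toReal) ((μ ⊗ₘ κ).map Prod.fst) :=
    (measurable_comp_of_convexOn hφ (Measure.measurable_rnDeriv Q μ).ennreal_toReal
      fun _ => ENNReal.toReal_nonneg).aestronglyMeasurable
  have hfst : (μ ⊗ₘ κ).map Prod.fst = μ := Measure.fst_compProd μ κ
  have hcompProd : Integrable (fun p : Ω × Ω' => φ (Q.rnDeriv μ p.1).toReal) (μ ⊗ₘ κ) :=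
    (hfst.symm ▸ hint : Integrable (fun x => φ (Q.rnDeriv μ x).toReal)
      ((μ ⊗ₘ κ).map Prod.fst)).comp_measurable measurable_fst
  calc phiDiv φ (κ ∘ₘ Q) (κ ∘ₘ μ)
      = phiDiv φ ((Q ⊗ₘ κ).map Prod.snd) ((μ ⊗ₘ κ).map Prod.snd) := by
        rw [← Measure.snd_compProd, ← Measure.snd_compProd, Measure.snd, Measure.snd]
    _ ≤ phiDiv φ (Q ⊗ₘ κ) (μ ⊗ₘ κ) := phiDiv_map_le hφ measurable_snd
    _ = phiDiv φ Q μ := by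
        rw [phiDiv_of_absolutelyContinuous hac hint, phiDiv_of_absolutelyContinuous
          (hac.compProd_left κ) ((integrable_congr hcongr).mpr hcompProd),
          integral_congr_ae hcongr, ← integral_map measurable_fst.aemeasurable hmeas, hfst]

end DataProcessing

lemma phiDiv_self {Ω : Type*} [MeasurableSpace Ω] {φ : ℝ → ℝ} (hφ1 : φ 1 = 0) (μ : Measure Ω)
    [SigmaFinite μ] : phiDiv φ μ μ = 0 := by
  have h : (fun x => φ (μ.rnDeriv μ x).toReal) =ᵐ[μ] 0 := by
    filter_upwards [Measure.rnDeriv_self μ] with x hx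
    simp [hx, hφ1]
  rw [phiDiv_of_absolutelyContinuous .rfl ((integrable_congr h).mpr (integrable_zero _ _ _)),
    integral_congr_ae h]
  simp

lemma phiDiv_nonneg {Ω : Type*} [MeasurableSpace Ω] {φ : ℝ → ℝ} (hφ : ConvexOn ℝ (Ici 0) φ)
    (hφ1 : φ 1 = 0) (Q μ : Measure Ω) [IsProbabilityMeasure Q] [IsProbabilityMeasure μ] :
    0 ≤ phiDiv φ Q μ := by
  have hconst : ∀ ν : Measure Ω, IsProbabilityMeasure ν →
      ν.map (fun _ => ()) = Measure.dirac () := fun ν _ => by simp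
  rw [← phiDiv_self hφ1 (Measure.dirac ()), ← hconst Q inferInstance]
  nth_rw 2 [hconst Q inferInstance]
  rw [← hconst μ inferInstance]
  exact phiDiv_map_le hφ measurable_const

section MutualInfo

variable {𝓧 𝓨 𝓧' 𝓨' : Type*} [MeasurableSpace 𝓧] [MeasurableSpace 𝓨] [MeasurableSpace 𝓧']
  [MeasurableSpace 𝓨'] {φ : ℝ → ℝ} {f : 𝓧 → 𝓧'} {g : 𝓨 → 𝓨'}

lemma phiMutualInfo_nonneg (hφ : ConvexOn ℝ (Ici 0) φ) (hφ1 : φ 1 = 0) (Q : Measure (𝓧 × 𝓨))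
    [IsProbabilityMeasure Q] : 0 ≤ phiMutualInfo φ Q :=
  phiDiv_nonneg hφ hφ1 _ _

lemma fst_prod_snd_map_prodMap (Q : Measure (𝓧 × 𝓨)) [IsFiniteMeasure Q] (hf : Measurable f)
    (hg : Measurable g) :
    (Q.map (Prod.map f g)).fst.prod (Q.map (Prod.map f g)).snd
      = (Q.fst.prod Q.snd).map (Prod.map f g) := by
  have hfst : (Q.map (Prod.map f g)).fst = Q.fst.map f := by
    rw [Measure.fst, Measure.fst, Measure.map_map measurable_fst (hf.prodMap hg),
      Measure.map_map hf measurable_fst]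
    rfl
  have hsnd : (Q.map (Prod.map f g)).snd = Q.snd.map g := by
    rw [Measure.snd, Measure.snd, Measure.map_map measurable_snd (hf.prodMap hg),
      Measure.map_map hg measurable_snd]
    rfl
  rw [hfst, hsnd, Measure.map_prod_map _ _ hf hg]

lemma phiMutualInfo_map_prodMap_le (hφ : ConvexOn ℝ (Ici 0) φ) (Q : Measure (𝓧 × 𝓨))
    [IsFiniteMeasure Q] (hf : Measurable f) (hg : Measurable g) :
    phiMutualInfo φ (Q.map (Prod.map f g)) ≤ phiMutualInfo φ Q := by
  rw [phiMutualInfo, phiMutualInfo, fst_prod_snd_map_prodMap Q hf hg]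
  exact phiDiv_map_le hφ (hf.prodMap hg)

end MutualInfo

section Contraction

variable {𝓧 𝓨 𝓩 : Type*} [MeasurableSpace 𝓧] [MeasurableSpace 𝓨] [MeasurableSpace 𝓩] {φ : ℝ → ℝ}

lemma toENNReal_phiDiv_comp_le (hφ : ConvexOn ℝ (Ici 0) φ) (hφ1 : φ 1 = 0) {ν μ : Measure 𝓧}
    [IsProbabilityMeasure ν] [IsProbabilityMeasure μ] (hac : ν ≪ μ) (htop : phiDiv φ ν μ ≠ ⊤)
    (κ : Kernel 𝓧 𝓨) [IsMarkovKernel κ] :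
    (phiDiv φ (κ ∘ₘ ν) (κ ∘ₘ μ)).toENNReal ≤ eta φ μ κ * (phiDiv φ ν μ).toENNReal := by
  rcases eq_or_ne ν μ with rfl | hne
  · simp [phiDiv_self hφ1]
  rcases eq_or_ne (phiDiv φ ν μ).toENNReal 0 with h0 | h0
  · rw [h0, mul_zero, ← h0]
    exact EReal.toENNReal_le_toENNReal (phiDiv_comp_le hφ hac)
  · rw [← ENNReal.div_le_iff h0 (EReal.toENNReal_ne_top_iff.mpr htop)]
    exact le_iSup₂_of_le ν inferInstance (le_iSup₂_of_le hac hne le_rfl)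

lemma eta_le_etaSup (φ : ℝ → ℝ) (μ : Measure 𝓧) [IsProbabilityMeasure μ] (κ : Kernel 𝓧 𝓨) :
    eta φ μ κ ≤ etaSup φ κ :=
  le_iSup₂_of_le μ inferInstance le_rfl

end Contraction

lemma rnDeriv_le_of_le_smul {Ω : Type*} [MeasurableSpace Ω] {ν μ : Measure Ω}
    [SigmaFinite μ] {c : ℝ≥0∞} (h : ν ≤ c • μ) : ∀ᵐ x ∂μ, ν.rnDeriv μ x ≤ c := by
  refine ae_le_of_forall_setLIntegral_le_of_sigmaFinite (Measure.measurable_rnDeriv ν μ)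
    fun s _ _ => ?_
  calc ∫⁻ x in s, ν.rnDeriv μ x ∂μ ≤ ν s := Measure.setLIntegral_rnDeriv_le s
    _ ≤ (c • μ) s := h s
    _ = ∫⁻ _ in s, c ∂μ := by simp

lemma integrable_comp_rnDeriv_of_le_smul {Ω : Type*} [MeasurableSpace Ω] {φ : ℝ → ℝ}
    (hφ : ConvexOn ℝ (Ici 0) φ) {ν μ : Measure Ω} [IsFiniteMeasure ν] [IsFiniteMeasure μ]
    {c : ℝ≥0∞} (hc : c ≠ ⊤) (h : ν ≤ c • μ) :
    Integrable (fun x => φ (ν.rnDeriv μ x).toReal) μ := by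
  refine integrable_comp_of_le hφ (Measure.measurable_rnDeriv ν μ).ennreal_toReal
    (fun _ => ENNReal.toReal_nonneg) Measure.integrable_toReal_rnDeriv
    (integrable_const (max (φ 0) (φ c.toReal))) ?_
  filter_upwards [rnDeriv_le_of_le_smul h] with x hx
  exact hφ.le_max_of_mem_Icc self_mem_Ici ENNReal.toReal_nonneg
    ⟨ENNReal.toReal_nonneg, ENNReal.toReal_mono hc hx⟩

section ChainRule

variable {𝓧 𝓨 : Type*} [MeasurableSpace 𝓧] [MeasurableSpace 𝓨] {μ : Measure 𝓧}
  [IsFiniteMeasure μ] {κ η : Kernel 𝓧 𝓨} [MeasurableSpace.CountableOrCountablyGenerated 𝓧 𝓨]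

lemma compProd_eq_withDensity_rnDeriv [IsFiniteKernel κ] [IsFiniteKernel η]
    (hac : ∀ᵐ x ∂μ, κ x ≪ η x) :
    μ ⊗ₘ κ = (μ ⊗ₘ η).withDensity fun p => κ.rnDeriv η p.1 p.2 := by
  rw [← Measure.compProd_withDensity (Kernel.measurable_rnDeriv κ η)]
  exact Measure.compProd_congr
    (hac.mono fun x hx => (Kernel.withDensity_rnDeriv_eq hx).symm)

lemma phiDiv_eq_integral_kernel_rnDeriv [IsFiniteKernel κ] [IsFiniteKernel η] {φ : ℝ → ℝ} {x : 𝓧}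
    (hac : κ x ≪ η x) (hint : Integrable (fun y => φ (κ.rnDeriv η x y).toReal) (η x)) :
    phiDiv φ (κ x) (η x) = ((∫ y, φ (κ.rnDeriv η x y).toReal ∂η x : ℝ) : EReal) := by
  have hcongr : (fun y => φ (κ.rnDeriv η x y).toReal)
      =ᵐ[η x] fun y => φ ((κ x).rnDeriv (η x) y).toReal := by
    filter_upwards [Kernel.rnDeriv_eq_rnDeriv_measure (κ := κ) (η := η) (a := x)] with y hy
      using by rw [hy]
  rw [phiDiv_of_absolutelyContinuous hac ((integrable_congr hcongr).mp hint),
    integral_congr_ae hcongr]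

lemma toENNReal_phiDiv_compProd [IsMarkovKernel κ] [IsMarkovKernel η] {φ : ℝ → ℝ}
    (hφ : ConvexOn ℝ (Ici 0) φ) (hφ1 : φ 1 = 0) (hac : ∀ᵐ x ∂μ, κ x ≪ η x)
    (hint : Integrable (fun p => φ ((μ ⊗ₘ κ).rnDeriv (μ ⊗ₘ η) p).toReal) (μ ⊗ₘ η)) :
    (phiDiv φ (μ ⊗ₘ κ) (μ ⊗ₘ η)).toENNReal
      = ∫⁻ x, (phiDiv φ (κ x) (η x)).toENNReal ∂μ := by
  have hden := compProd_eq_withDensity_rnDeriv hac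
  have hcongr : (fun p => φ ((μ ⊗ₘ κ).rnDeriv (μ ⊗ₘ η) p).toReal)
      =ᵐ[μ ⊗ₘ η] fun p => φ (κ.rnDeriv η p.1 p.2).toReal := by
    rw [hden]
    filter_upwards [Measure.rnDeriv_withDensity (μ ⊗ₘ η) (Kernel.measurable_rnDeriv κ η)]
      with p hp using by rw [hp]
  have hint' := (integrable_congr hcongr).mp hint
  have hfibre : ∀ᵐ x ∂μ,
      phiDiv φ (κ x) (η x) = ((∫ y, φ (κ.rnDeriv η x y).toReal ∂η x : ℝ) : EReal) := by
    filter_upwards [hac, ((Measure.integrable_compProd_iff hint'.aestronglyMeasurable).mp hint').1]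
      with x hx hxint using phiDiv_eq_integral_kernel_rnDeriv hx hxint
  have hintegral : Integrable (fun x => ∫ y, φ (κ.rnDeriv η x y).toReal ∂η x) μ :=
    hint'.integral_compProd
  rw [phiDiv_of_absolutelyContinuous (hden ▸ withDensity_absolutelyContinuous _ _) hint,
    integral_congr_ae hcongr, Measure.integral_compProd hint', EReal.real_coe_toENNReal,
    ofReal_integral_eq_lintegral_ofReal hintegral ?_]
  · exact lintegral_congr_ae (hfibre.mono fun x hx => by simp only [hx, EReal.real_coe_toENNReal])
  · filter_upwards [hfibre] with x hx
    exact EReal.coe_nonneg.mp (hx ▸ phiDiv_nonneg hφ hφ1 (κ x) (η x))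

end ChainRule

section FiniteSource

variable {ι 𝓨 𝓩 : Type*} [MeasurableSpace ι] [MeasurableSingletonClass ι] [MeasurableSpace 𝓨]
  [MeasurableSpace 𝓩]

lemma apply_le_inv_smul_comp (p : Measure ι) [IsFiniteMeasure p] (κ : Kernel ι 𝓨) {i : ι}
    (hi : p {i} ≠ 0) : κ i ≤ (p {i})⁻¹ • (κ ∘ₘ p) := by
  refine Measure.le_iff.mpr fun s hs => ?_
  rw [Measure.smul_apply, smul_eq_mul, ← ENNReal.div_eq_inv_mul,
    ENNReal.le_div_iff_mul_le (.inl hi) (.inl (measure_ne_top _ _)),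
    Measure.bind_apply hs κ.aemeasurable, ← lintegral_singleton (fun a => κ a s)]
  exact setLIntegral_le_lintegral _ _

variable [Finite ι]

lemma exists_ae_le_smul_comp (p : Measure ι) [IsFiniteMeasure p] (κ : Kernel ι 𝓨) :
    ∃ c : ℝ≥0∞, c ≠ ⊤ ∧ ∀ᵐ i ∂p, κ i ≤ c • (κ ∘ₘ p) := by
  classical
  have := Fintype.ofFinite ι
  refine ⟨∑ i with p {i} ≠ 0, (p {i})⁻¹, by simp [ENNReal.sum_eq_top], ?_⟩
  refine (ae_iff_of_countable.mpr fun i hi => (apply_le_inv_smul_comp p κ hi).trans ?_)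
  gcongr
  exact Finset.single_le_sum (f := fun i => (p {i})⁻¹) (fun _ _ => zero_le) (by simp [hi])

lemma exists_compProd_le_smul_compProd_const_comp (p : Measure ι) [IsFiniteMeasure p]
    (κ : Kernel ι 𝓨) [IsMarkovKernel κ] :
    ∃ c : ℝ≥0∞, c ≠ ⊤ ∧ p ⊗ₘ κ ≤ c • (p ⊗ₘ Kernel.const ι (κ ∘ₘ p)) := by
  obtain ⟨c, hc, hle⟩ := exists_ae_le_smul_comp p κ
  refine ⟨c, hc, Measure.le_iff.mpr fun s hs => ?_⟩
  rw [Measure.smul_apply, smul_eq_mul, Measure.compProd_apply hs, Measure.compProd_apply hs,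
    ← lintegral_const_mul _ (Kernel.measurable_kernel_prodMk_left hs)]
  exact lintegral_mono_ae (hle.mono fun i hi => hi _)

variable {p : Measure ι} [IsProbabilityMeasure p] {κ : Kernel ι 𝓨} [IsMarkovKernel κ]
  {φ : ℝ → ℝ}

lemma toENNReal_phiMutualInfo_compProd (hφ : ConvexOn ℝ (Ici 0) φ) (hφ1 : φ 1 = 0) :
    (phiMutualInfo φ (p ⊗ₘ κ)).toENNReal
      = ∫⁻ i, (phiDiv φ (κ i) (κ ∘ₘ p)).toENNReal ∂p := by
  obtain ⟨c, -, hac⟩ := exists_ae_le_smul_comp p κ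
  obtain ⟨d, hd, hle⟩ := exists_compProd_le_smul_compProd_const_comp p κ
  rw [phiMutualInfo, Measure.fst_compProd, Measure.snd_compProd, ← Measure.compProd_const]
  exact toENNReal_phiDiv_compProd hφ hφ1
    (hac.mono fun i hi => Measure.absolutelyContinuous_of_le_smul hi)
    (integrable_comp_rnDeriv_of_le_smul hφ hd hle)

lemma toENNReal_phiMutualInfo_compProd_comp_le (hφ : ConvexOn ℝ (Ici 0) φ) (hφ1 : φ 1 = 0)
    (T : Kernel 𝓨 𝓩) [IsMarkovKernel T] :
    (phiMutualInfo φ (p ⊗ₘ (T ∘ₖ κ))).toENNReal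
      ≤ eta φ (κ ∘ₘ p) T * (phiMutualInfo φ (p ⊗ₘ κ)).toENNReal := by
  rw [toENNReal_phiMutualInfo_compProd hφ hφ1, toENNReal_phiMutualInfo_compProd hφ hφ1,
    ← Measure.comp_assoc, ← lintegral_const_mul _ (measurable_of_finite _)]
  obtain ⟨c, hc, hle⟩ := exists_ae_le_smul_comp p κ
  refine lintegral_mono_ae (hle.mono fun i hi => ?_)
  have hac := Measure.absolutelyContinuous_of_le_smul hi
  rw [Kernel.comp_apply]
  exact toENNReal_phiDiv_comp_le hφ hφ1 hac
    (phiDiv_of_absolutelyContinuous hac (integrable_comp_rnDeriv_of_le_smul hφ hc hi) ▸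
      EReal.coe_ne_top _) T

end FiniteSource

section FiniteSpace

variable {α : Type*} [MeasurableSpace α] [MeasurableSingletonClass α] {Q μ : Measure α}
  [IsFiniteMeasure Q] [IsFiniteMeasure μ]

lemma toReal_rnDeriv_of_singleton_ne_zero (hac : Q ≪ μ) {a : α} (ha : μ {a} ≠ 0) :
    (Q.rnDeriv μ a).toReal = Q.real {a} / μ.real {a} := by
  rw [eq_div_iff ((measureReal_eq_zero_iff).not.mpr ha), Measure.real, Measure.real,
    ← ENNReal.toReal_mul, ← lintegral_singleton, Measure.setLIntegral_rnDeriv hac]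

lemma phiDiv_eq_sum [Fintype α] (φ : ℝ → ℝ) (hac : Q ≪ μ) :
    phiDiv φ Q μ = ((∑ a, μ.real {a} * φ (Q.real {a} / μ.real {a}) : ℝ) : EReal) := by
  rw [phiDiv_of_absolutelyContinuous hac .of_finite, integral_fintype .of_finite]
  congr 1
  refine Finset.sum_congr rfl fun a _ => ?_
  by_cases ha : μ {a} = 0
  · simp [Measure.real, ha]
  · rw [toReal_rnDeriv_of_singleton_ne_zero hac ha, smul_eq_mul]

end FiniteSpace

lemma measureReal_mul_sub_le_phiDiv {Ω : Type*} [MeasurableSpace Ω] {φ : ℝ → ℝ}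
    (hφ : ConvexOn ℝ (Ici 0) φ) {c : ℝ} (hc : ∀ t, 0 ≤ t → -c ≤ φ t) {Q μ : Measure Ω}
    [IsFiniteMeasure Q] [IsProbabilityMeasure μ] (hac : Q ≪ μ) {S : Set Ω} (hS : MeasurableSet S) :
    ((μ.real S * φ (Q.real S / μ.real S) - (1 - μ.real S) * c : ℝ) : EReal) ≤ phiDiv φ Q μ := by
  have hmem : Measurable (· ∈ S) := measurable_mem.mpr hS
  have htrue : (· ∈ S) ⁻¹' {True} = S := by ext; simp
  have hfalse : (· ∈ S) ⁻¹' {False} = Sᶜ := by ext; simp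
  refine le_trans (EReal.coe_le_coe_iff.mpr ?_)
    ((phiDiv_eq_sum φ (hac.map hmem)).symm.trans_le (phiDiv_map_le hφ hmem))
  rw [Fintype.univ_Prop, Finset.sum_pair (by simp)]
  simp only [map_measureReal_apply hmem (measurableSet_singleton _), htrue, hfalse,
    probReal_compl_eq_one_sub hS (μ := μ)]
  have hcompl := mul_le_mul_of_nonneg_left
    (hc (Q.real Sᶜ / (1 - μ.real S)) (div_nonneg measureReal_nonneg (by simp)))
    (sub_nonneg.mpr (measureReal_le_one (μ := μ) (s := S)))
  linarith

section Quantisation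

variable {𝓦 𝓥 ι : Type*} [MeasurableSpace 𝓦] [MeasurableSpace 𝓥] [MeasurableSpace ι]
  {π : Measure 𝓦} {idx : 𝓦 → ι}

lemma exists_compProd_eq_map_graph [Finite ι] [MeasurableSingletonClass ι]
    [IsProbabilityMeasure π] (hidx : Measurable idx) :
    ∃ R : Kernel ι 𝓦, IsMarkovKernel R ∧ π.map idx ⊗ₘ R = π.map fun w => (idx w, w) := by
  classical
  have := Fintype.ofFinite ι
  let R : Kernel ι 𝓦 := Kernel.ofFunOfCountable fun i =>
    if π (idx ⁻¹' {i}) = 0 then π else π[|idx ⁻¹' {i}]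
  have hR (i : ι) : R i = if π (idx ⁻¹' {i}) = 0 then π else π[|idx ⁻¹' {i}] := rfl
  have hMarkov : IsMarkovKernel R := ⟨fun i => by
    rw [hR]
    split_ifs with h
    · infer_instance
    · exact cond_isProbabilityMeasure h⟩
  refine ⟨R, hMarkov, Measure.ext fun s hs => ?_⟩
  rw [Measure.compProd_apply hs, lintegral_fintype,
    Measure.map_apply (hidx.prodMk measurable_id') hs]
  nth_rw 2 [← sum_meas_smul_cond_fiber hidx π]
  rw [Measure.finsetSum_apply]
  refine Finset.sum_congr rfl fun i _ => ?_
  have hfib : MeasurableSet (idx ⁻¹' {i}) := hidx (measurableSet_singleton i)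
  have hinter : idx ⁻¹' {i} ∩ Prod.mk i ⁻¹' s = idx ⁻¹' {i} ∩ (fun w => (idx w, w)) ⁻¹' s := by
    ext w
    simp +contextual [eq_comm]
  rw [Measure.map_apply hidx (measurableSet_singleton i), Measure.smul_apply, smul_eq_mul, mul_comm]
  by_cases h : π (idx ⁻¹' {i}) = 0
  · simp only [h, zero_mul]
  · rw [hR, if_neg h, cond_apply hfib, cond_apply hfib, hinter]

lemma map_compProd_comp_eq_map (hidx : Measurable idx) [SFinite π]
    {R : Kernel ι 𝓦} [IsSFiniteKernel R] (hR : π.map idx ⊗ₘ R = π.map fun w => (idx w, w))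
    (κ : Kernel 𝓦 𝓥) [IsSFiniteKernel κ] :
    π.map idx ⊗ₘ (κ ∘ₖ R) = (π ⊗ₘ κ).map (Prod.map idx id) := by
  ext s hs
  have hmeas : Measurable fun p : ι × 𝓦 => κ p.2 (Prod.mk p.1 ⁻¹' s) := by
    exact Kernel.measurable_kernel_prodMk_left (κ := Kernel.prodMkLeft ι κ)
      (t := {q : (ι × 𝓦) × 𝓥 | (q.1.1, q.2) ∈ s}) (measurable_fst.fst.prodMk measurable_snd hs)
  rw [Measure.compProd_apply hs, Measure.map_apply (hidx.prodMap measurable_id) hs,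
    Measure.compProd_apply ((hidx.prodMap measurable_id) hs)]
  simp only [Kernel.comp_apply' _ _ _ (measurable_prodMk_left hs)]
  rw [← Measure.lintegral_compProd hmeas, hR, lintegral_map hmeas (hidx.prodMk measurable_id')]
  rfl

end Quantisation

/-- `D_φ`-mutual information of at most `I` between every finite quantisation of the first
coordinate and the second coordinate, under the joint law `Q`. Quantisations take values in
`Type`, which contains finite types of every cardinality. -/
def QuantisedMutualInfoLE {𝓦 𝓥 : Type*} [MeasurableSpace 𝓦] [MeasurableSpace 𝓥] (φ : ℝ → ℝ)
    (Q : Measure (𝓦 × 𝓥)) (I : EReal) : Prop :=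
  ∀ (ι : Type) [Finite ι] [MeasurableSpace ι] [MeasurableSingletonClass ι] (idx : 𝓦 → ι),
    Measurable idx → phiMutualInfo φ (Q.map (Prod.map idx id)) ≤ I

section Contraction

variable {𝓦 𝓧 𝓩 𝓥 : Type*} [MeasurableSpace 𝓦] [MeasurableSpace 𝓧] [MeasurableSpace 𝓩]
  [MeasurableSpace 𝓥] {φ : ℝ → ℝ} {π : Measure 𝓦} [IsProbabilityMeasure π]
  {P : Kernel 𝓦 𝓧} [IsMarkovKernel P] {T : Kernel 𝓧 𝓩} {E : Kernel 𝓩 𝓥}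

/-- The joint law of `(W, Ŵ)` in the Markov chain `W - X - Z - Ŵ` with prior `π` and kernels `P`,
`T`, `E`: this is `jointWEst` with an arbitrary channel `T` in place of a tensor power. -/
def chainLaw (π : Measure 𝓦) (P : Kernel 𝓦 𝓧) (T : Kernel 𝓧 𝓩) (E : Kernel 𝓩 𝓥) :
    Measure (𝓦 × 𝓥) :=
  π ⊗ₘ (E ∘ₖ (T ∘ₖ P))

/-- The bound `η_φ(E) η_φ(P_X, T) I_φ(W, X)` on the information about `W` at the end of the chain
of `chainLaw`: this is `contractedInfo` with an arbitrary channel `T` in place of a tensor power. -/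
def contractedMutualInfo (φ : ℝ → ℝ) (π : Measure 𝓦) (P : Kernel 𝓦 𝓧) (T : Kernel 𝓧 𝓩)
    (E : Kernel 𝓩 𝓥) : EReal :=
  (etaSup φ E : EReal) * (eta φ (P ∘ₘ π) T : EReal) * phiMutualInfo φ (π ⊗ₘ P)

instance [IsMarkovKernel T] [IsMarkovKernel E] : IsProbabilityMeasure (chainLaw π P T E) :=
  inferInstanceAs (IsProbabilityMeasure (π ⊗ₘ (E ∘ₖ (T ∘ₖ P))))

lemma coe_toENNReal_contractedMutualInfo (hφ : ConvexOn ℝ (Ici 0) φ) (hφ1 : φ 1 = 0) :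
    contractedMutualInfo φ π P T E
      = ((etaSup φ E * (eta φ (P ∘ₘ π) T * (phiMutualInfo φ (π ⊗ₘ P)).toENNReal) : ℝ≥0∞) :
        EReal) := by
  rw [EReal.coe_ennreal_mul, EReal.coe_ennreal_mul,
    EReal.coe_toENNReal (phiMutualInfo_nonneg hφ hφ1 _),
    ← mul_assoc, contractedMutualInfo]

lemma quantisedMutualInfoLE_contractedMutualInfo [IsMarkovKernel T] [IsMarkovKernel E]
    (hφ : ConvexOn ℝ (Ici 0) φ) (hφ1 : φ 1 = 0) :
    QuantisedMutualInfoLE φ (chainLaw π P T E) (contractedMutualInfo φ π P T E) := by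
  intro ι _ _ _ idx hidx
  obtain ⟨R, hMarkov, hR⟩ := exists_compProd_eq_map_graph (π := π) hidx
  have hprob : IsProbabilityMeasure (π.map idx) :=
    Measure.isProbabilityMeasure_map hidx.aemeasurable
  have hjoint := map_compProd_comp_eq_map hidx hR (E ∘ₖ (T ∘ₖ P))
  have hsource := map_compProd_comp_eq_map hidx hR P
  have hmarginal : (P ∘ₖ R) ∘ₘ π.map idx = P ∘ₘ π := by
    rw [← Measure.comp_assoc, ← Measure.snd_compProd _ R, hR, Measure.snd_map_prodMk hidx,
      Measure.map_id']
  have hchain : E ∘ₖ (T ∘ₖ P) ∘ₖ R = E ∘ₖ (T ∘ₖ (P ∘ₖ R)) := by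
    rw [Kernel.comp_assoc, Kernel.comp_assoc]
  rw [coe_toENNReal_contractedMutualInfo hφ hφ1, chainLaw, ← hjoint, hchain,
    ← EReal.coe_toENNReal (phiMutualInfo_nonneg hφ hφ1 _),
    EReal.coe_ennreal_le_coe_ennreal_iff]
  calc (phiMutualInfo φ (π.map idx ⊗ₘ (E ∘ₖ (T ∘ₖ (P ∘ₖ R))))).toENNReal
      ≤ eta φ ((T ∘ₖ (P ∘ₖ R)) ∘ₘ π.map idx) E
          * (phiMutualInfo φ (π.map idx ⊗ₘ (T ∘ₖ (P ∘ₖ R)))).toENNReal :=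
        toENNReal_phiMutualInfo_compProd_comp_le hφ hφ1 E
    _ ≤ etaSup φ E * (eta φ ((P ∘ₖ R) ∘ₘ π.map idx) T
          * (phiMutualInfo φ (π.map idx ⊗ₘ (P ∘ₖ R))).toENNReal) := by
        gcongr
        · exact eta_le_etaSup φ _ E
        · exact toENNReal_phiMutualInfo_compProd_comp_le hφ hφ1 T
    _ ≤ etaSup φ E * (eta φ (P ∘ₘ π) T * (phiMutualInfo φ (π ⊗ₘ P)).toENNReal) := by
        rw [hmarginal, hsource]
        gcongr
        exact EReal.toENNReal_le_toENNReal (phiMutualInfo_map_prodMap_le hφ _ hidx measurable_id)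

end Contraction

section Approximation

variable {𝓦 𝓥 : Type*} [MeasurableSpace 𝓦] [MeasurableSpace 𝓥]

/-- The measurable sets that depend on the first coordinate only through a quantisation with
finitely many values, so that `QuantisedMutualInfoLE` controls their probabilities. -/
def finiteSectionSets (𝓦 𝓥 : Type*) [MeasurableSpace 𝓦] [MeasurableSpace 𝓥] :
    Set (Set (𝓦 × 𝓥)) :=
  {B | ∃ (ι : Type) (_ : Finite ι) (_ : MeasurableSpace ι) (_ : MeasurableSingletonClass ι)
    (idx : 𝓦 → ι) (S : Set (ι × 𝓥)), Measurable idx ∧ MeasurableSet S ∧ B = Prod.map idx id ⁻¹' S}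

lemma isSetAlgebra_finiteSectionSets : IsSetAlgebra (finiteSectionSets 𝓦 𝓥) where
  empty_mem := ⟨Unit, inferInstance, inferInstance, inferInstance, fun _ => (), ∅,
    measurable_const, .empty, by simp⟩
  compl_mem := by
    rintro _ ⟨ι, _, _, _, idx, S, hidx, hS, rfl⟩
    exact ⟨ι, ‹_›, ‹_›, ‹_›, idx, Sᶜ, hidx, hS.compl, rfl⟩
  union_mem := by
    rintro _ _ ⟨ι, _, _, _, idx, S, hidx, hS, rfl⟩ ⟨ι', _, _, _, idx', S', hidx', hS', rfl⟩
    refine ⟨ι × ι', inferInstance, inferInstance, inferInstance, fun w => (idx w, idx' w),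
      (fun p => (p.1.1, p.2)) ⁻¹' S ∪ (fun p => (p.1.2, p.2)) ⁻¹' S', hidx.prodMk hidx', ?_, rfl⟩
    exact (measurable_fst.fst.prodMk measurable_snd hS).union
      (measurable_fst.snd.prodMk measurable_snd hS')

lemma generateFrom_finiteSectionSets :
    MeasurableSpace.generateFrom (finiteSectionSets 𝓦 𝓥) = Prod.instMeasurableSpace := by
  refine le_antisymm (MeasurableSpace.generateFrom_le ?_) ?_
  · rintro _ ⟨ι, _, _, _, idx, S, hidx, hS, rfl⟩
    exact (hidx.prodMap measurable_id) hS
  · rw [← generateFrom_prod]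
    refine MeasurableSpace.generateFrom_mono ?_
    rintro _ ⟨s, hs, t, ht, rfl⟩
    refine ⟨Prop, inferInstance, inferInstance, inferInstance, (· ∈ s),
      {p | p.1} ∩ {p | p.2 ∈ t}, measurable_mem.mpr hs, ?_, by ext; simp⟩
    exact (measurable_fst (measurableSet_setOfPred.mpr measurable_id)).inter (measurable_snd ht)

end Approximation

section Algebra

variable {Ω : Type*} [m : MeasurableSpace Ω] {𝓐 : Set (Set Ω)} {ν Q μ : Measure Ω}
  [IsFiniteMeasure Q] [IsFiniteMeasure μ]

lemma dist_measureReal_lt_of_le {A B : Set Ω} {ε : ℝ} (hQν : Q ≤ ν)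
    (hA : MeasurableSet A) (hB : MeasurableSet B) (h : ν (B ∆ A) < ENNReal.ofReal ε) :
    dist (Q.real A) (Q.real B) < ε := by
  rw [dist_comm, Real.dist_eq]
  refine (abs_measureReal_sub_le_measureReal_symmDiff hB.nullMeasurableSet
    hA.nullMeasurableSet).trans_lt ?_
  exact (ENNReal.ofReal_lt_ofReal_iff_of_nonneg measureReal_nonneg).mp
    ((ofReal_measureReal (μ := Q)).trans_lt ((hQν _).trans_lt h))

lemma measureReal_pair_mem_of_isSetAlgebra (h𝓐 : IsSetAlgebra 𝓐)
    (hgen : MeasurableSpace.generateFrom 𝓐 = m) {F : Set (ℝ × ℝ)} (hF : IsClosed F)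
    (h : ∀ A ∈ 𝓐, (Q.real A, μ.real A) ∈ F) {B : Set Ω} (hB : MeasurableSet B) :
    (Q.real B, μ.real B) ∈ F := by
  have hdense := Measure.MeasureDense.of_generateFrom_isSetAlgebra_finite (μ := Q + μ) h𝓐 hgen.symm
  refine hF.closure_eq ▸ Metric.mem_closure_iff.mpr fun ε hε => ?_
  obtain ⟨A, hA, hlt⟩ := hdense.approx B hB (measure_ne_top _ _) ε hε
  have hAm := hdense.measurable A hA
  refine ⟨_, h A hA, ?_⟩
  rw [dist_comm, Prod.dist_eq]
  exact max_lt (dist_measureReal_lt_of_le (Measure.le_add_right le_rfl) hAm hB hlt)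
    (dist_measureReal_lt_of_le (Measure.le_add_left le_rfl) hAm hB hlt)

end Algebra

lemma absolutelyContinuous_fst_prod_snd {ι 𝓨 : Type*} [MeasurableSpace ι] [MeasurableSpace 𝓨]
    [Countable ι] [MeasurableSingletonClass ι] (Q : Measure (ι × 𝓨)) [SFinite Q] :
    Q ≪ Q.fst.prod Q.snd := by
  refine .mk fun s hs hnull => ?_
  rw [Measure.measure_prod_null hs, EventuallyEq, ae_iff_of_countable] at hnull
  have hcover : s ⊆ ⋃ i, {i} ×ˢ (Prod.mk i ⁻¹' s) := fun p hp => by simpa using hp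
  refine measure_mono_null hcover (measure_iUnion_null fun i => ?_)
  by_cases hi : Q.fst {i} = 0
  · refine measure_mono_null (fun p hp => hp.1) ?_
    rwa [Measure.fst_apply (measurableSet_singleton i)] at hi
  · have hsnd := hnull i hi
    rw [Measure.snd_apply (measurable_prodMk_left hs)] at hsnd
    exact measure_mono_null (fun p hp => hp.2) hsnd

section BinaryBound

variable {φ : ℝ → ℝ} {q r J c L t : ℝ}

-- Sets approximating an event of probability at most `L` may have probability `r > L`; with
-- `max L r` the conclusion is defined for these too and is a closed condition on `(q, r)`.
lemma le_mul_max_of_monotoneOn (hφ : ConvexOn ℝ (Ici 0) φ) (hmono : MonotoneOn φ (Ici 0))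
    (hq : 0 ≤ q) (hr : 0 ≤ r) (hrq : r = 0 → q = 0)
    (hbound : r * φ (q / r) - (1 - r) * -φ 0 ≤ J) (hL : 0 < L) (ht : 0 ≤ t)
    (hJ : J - φ 0 < L * (φ t - φ 0)) : q ≤ t * max L r := by
  by_contra! hlt
  have hLr : L ≤ max L r := le_max_left _ _
  have hr' : 0 < r := hr.lt_of_ne fun h =>
    ((mul_nonneg ht (hL.le.trans hLr)).trans_lt hlt).ne' (hrq h.symm)
  set L' := max L r
  have hL' : 0 < L' := hL.trans_le hLr
  have hratio : φ t ≤ φ (q / L') :=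
    hmono ht (div_nonneg hq hL'.le) ((le_div_iff₀ hL').mpr hlt.le)
  have hchord : φ (q / L') ≤ r / L' * φ (q / r) + (1 - r / L') * φ 0 := by
    have := hφ.2 (div_nonneg hq hr : q / r ∈ Ici (0 : ℝ)) (le_refl (0 : ℝ))
      (div_nonneg hr hL'.le) (sub_nonneg.mpr ((div_le_one hL').mpr (le_max_right _ _)))
      (add_sub_cancel _ _)
    rwa [smul_zero, add_zero, smul_eq_mul, smul_eq_mul, smul_eq_mul,
      show r / L' * (q / r) = q / L' by field_simp] at this
  have hscaled : L' * (φ t - φ 0) ≤ r * (φ (q / r) - φ 0) := by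
    calc L' * (φ t - φ 0) ≤ L' * (r / L' * (φ (q / r) - φ 0)) := by
          gcongr
          linarith
      _ = r * (φ (q / r) - φ 0) := by field_simp
  have hLL' : L * (φ t - φ 0) ≤ L' * (φ t - φ 0) :=
    mul_le_mul_of_nonneg_right hLr (sub_nonneg.mpr (hmono (le_refl (0 : ℝ)) ht ht))
  linarith

lemma mul_le_or_mul_le_of_antitoneOn (hanti : AntitoneOn φ (Ici 0)) (hq : 0 ≤ q) (hr : 0 ≤ r)
    (hbound : r * φ (q / r) - (1 - r) * c ≤ J) (ht : 0 ≤ t) :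
    t * r ≤ q ∨ r * (φ t + c) ≤ J + c := by
  refine or_iff_not_imp_left.mpr fun hlt => ?_
  rw [not_le] at hlt
  have hr' : 0 < r := hr.lt_of_ne fun h => by simp [← h, hq.not_gt] at hlt
  have hratio : φ t ≤ φ (q / r) :=
    hanti (div_nonneg hq hr) ht ((div_le_iff₀ hr').mpr hlt.le)
  linarith [mul_le_mul_of_nonneg_left hratio hr]

end BinaryBound

section SetAlgebra

variable {Ω : Type*} [m : MeasurableSpace Ω] {𝓐 : Set (Set Ω)} {Q μ : Measure Ω}
  [IsFiniteMeasure Q] [IsFiniteMeasure μ] {φ : ℝ → ℝ} {B : Set Ω} {J c L t : ℝ}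

lemma measureReal_le_mul_of_monotoneOn (h𝓐 : IsSetAlgebra 𝓐)
    (hgen : MeasurableSpace.generateFrom 𝓐 = m) (hφ : ConvexOn ℝ (Ici 0) φ)
    (hmono : MonotoneOn φ (Ici 0)) (hnull : ∀ A ∈ 𝓐, μ.real A = 0 → Q.real A = 0)
    (hbound : ∀ A ∈ 𝓐, μ.real A * φ (Q.real A / μ.real A) - (1 - μ.real A) * -φ 0 ≤ J)
    (hB : MeasurableSet B) (hL : 0 < L) (hBL : μ.real B ≤ L) (ht : 0 ≤ t)
    (hJ : J - φ 0 < L * (φ t - φ 0)) : Q.real B ≤ t * L := by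
  have hclosed : IsClosed {p : ℝ × ℝ | p.1 ≤ t * max L p.2} :=
    isClosed_le continuous_fst (by fun_prop)
  have hB := measureReal_pair_mem_of_isSetAlgebra h𝓐 hgen hclosed (fun A hA =>
    le_mul_max_of_monotoneOn hφ hmono measureReal_nonneg measureReal_nonneg (hnull A hA)
      (hbound A hA) hL ht hJ) hB
  simpa only [mem_ofPred_eq, max_eq_left hBL] using hB

lemma mul_measureReal_le_or_of_antitoneOn (h𝓐 : IsSetAlgebra 𝓐)
    (hgen : MeasurableSpace.generateFrom 𝓐 = m) (hanti : AntitoneOn φ (Ici 0))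
    (hbound : ∀ A ∈ 𝓐, μ.real A * φ (Q.real A / μ.real A) - (1 - μ.real A) * c ≤ J)
    (hB : MeasurableSet B) (ht : 0 ≤ t) :
    t * μ.real B ≤ Q.real B ∨ μ.real B * (φ t + c) ≤ J + c := by
  have hclosed : IsClosed {p : ℝ × ℝ | t * p.2 ≤ p.1 ∨ p.2 * (φ t + c) ≤ J + c} :=
    (isClosed_le (continuous_const.mul continuous_snd) continuous_fst).union
      (isClosed_le (continuous_snd.mul continuous_const) continuous_const)
  exact measureReal_pair_mem_of_isSetAlgebra h𝓐 hgen hclosed (fun A hA =>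
    mul_le_or_mul_le_of_antitoneOn hanti measureReal_nonneg measureReal_nonneg (hbound A hA) ht) hB

end SetAlgebra

section Conjugate

variable {φ : ℝ → ℝ}

lemma neg_coe_le_conjugate_zero (φ : ℝ → ℝ) {t : ℝ} (ht : 0 ≤ t) :
    ((-φ t : ℝ) : EReal) ≤ conjugate φ 0 :=
  le_iSup₂_of_le (f := fun (t : ℝ) (_ : 0 ≤ t) => ((t * 0 - φ t : ℝ) : EReal)) t ht (by simp)

lemma conjugate_zero_nonneg (hφ1 : φ 1 = 0) : 0 ≤ conjugate φ 0 := by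
  simpa [hφ1] using neg_coe_le_conjugate_zero φ zero_le_one

lemma conjugate_zero_of_monotoneOn (hmono : MonotoneOn φ (Ici 0)) :
    conjugate φ 0 = ((-φ 0 : ℝ) : EReal) := by
  refine le_antisymm (iSup₂_le fun t ht => ?_) (neg_coe_le_conjugate_zero φ le_rfl)
  rw [mul_zero, zero_sub, EReal.coe_le_coe_iff, neg_le_neg_iff]
  exact hmono (le_refl (0 : ℝ)) ht ht

end Conjugate

lemma decInverse_le {φ : ℝ → ℝ} {x : ℝ} {y : EReal} (hx : 0 ≤ x)
    (h : ∀ t, x < t → (φ t : EReal) ≤ y) : decInverse φ y ≤ x :=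
  EReal.le_of_forall_lt_iff_le.mp fun t ht =>
    have hxt : x < t := EReal.coe_lt_coe_iff.mp ht
    iInf_le_of_le t (iInf₂_le_of_le (hx.trans hxt.le) (h t hxt) le_rfl)

lemma ne_top_and_ne_top_of_add_mul_ne_top {I C : EReal} {L : ℝ} (hI : 0 ≤ I) (hC : 0 ≤ C)
    (hL : 0 ≤ L) (hLC : 0 < L ∨ C ≠ ⊤) (h : I + L * C ≠ ⊤) : I ≠ ⊤ ∧ C ≠ ⊤ := by
  have hmul : 0 ≤ (L : EReal) * C := mul_nonneg (EReal.coe_nonneg.mpr hL) hC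
  refine ⟨fun hItop => h ?_, fun hCtop => h ?_⟩
  · rw [hItop, EReal.top_add_of_ne_bot (ne_bot_of_le_ne_bot EReal.zero_ne_bot hmul)]
  · rw [hCtop, EReal.mul_top_of_pos (EReal.coe_pos.mpr (hLC.resolve_right (absurd hCtop))),
      EReal.add_top_of_ne_bot (ne_bot_of_le_ne_bot EReal.zero_ne_bot hI)]

section Quantised

variable {𝓦 𝓥 : Type*} [MeasurableSpace 𝓦] [MeasurableSpace 𝓥] {φ : ℝ → ℝ} {Q : Measure (𝓦 × 𝓥)}
  {I : EReal} {A B : Set (𝓦 × 𝓥)} {c J L : ℝ}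

lemma measureReal_eq_zero_of_mem_finiteSectionSets [IsFiniteMeasure Q]
    (hA : A ∈ finiteSectionSets 𝓦 𝓥) (hnull : (Q.fst.prod Q.snd).real A = 0) : Q.real A = 0 := by
  obtain ⟨ι, _, _, _, idx, S, hidx, hS, rfl⟩ := hA
  have hmap : Measurable (Prod.map idx (id : 𝓥 → 𝓥)) := hidx.prodMap measurable_id
  rw [measureReal_eq_zero_iff] at hnull ⊢
  rw [← Measure.map_apply hmap hS] at hnull ⊢
  rw [← fst_prod_snd_map_prodMap Q hidx measurable_id] at hnull
  exact absolutelyContinuous_fst_prod_snd _ hnull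

variable [IsProbabilityMeasure Q]

lemma QuantisedMutualInfoLE.nonneg (hI : QuantisedMutualInfoLE φ Q I)
    (hφ : ConvexOn ℝ (Ici 0) φ) (hφ1 : φ 1 = 0) : 0 ≤ I :=
  have := Measure.isProbabilityMeasure_map (μ := Q)
    (measurable_const.prodMap measurable_id : Measurable (Prod.map (fun _ => ()) id)).aemeasurable
  (phiMutualInfo_nonneg hφ hφ1 _).trans (hI Unit (fun _ => ()) measurable_const)

lemma QuantisedMutualInfoLE.measureReal_mul_sub_le (hJ : QuantisedMutualInfoLE φ Q J)
    (hφ : ConvexOn ℝ (Ici 0) φ) (hc : ∀ t, 0 ≤ t → -c ≤ φ t) (hA : A ∈ finiteSectionSets 𝓦 𝓥) :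
    (Q.fst.prod Q.snd).real A * φ (Q.real A / (Q.fst.prod Q.snd).real A)
      - (1 - (Q.fst.prod Q.snd).real A) * c ≤ J := by
  obtain ⟨ι, _, _, _, idx, S, hidx, hS, rfl⟩ := hA
  have hmap : Measurable (Prod.map idx (id : 𝓥 → 𝓥)) := hidx.prodMap measurable_id
  have hprob := Measure.isProbabilityMeasure_map (μ := Q.fst.prod Q.snd) hmap.aemeasurable
  have hac := absolutelyContinuous_fst_prod_snd (Q.map (Prod.map idx id))
  rw [fst_prod_snd_map_prodMap Q hidx measurable_id] at hac
  have hset := measureReal_mul_sub_le_phiDiv hφ hc hac hS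
  rw [← fst_prod_snd_map_prodMap Q hidx measurable_id] at hset
  have hchain := hset.trans (hJ ι idx hidx)
  rwa [fst_prod_snd_map_prodMap Q hidx measurable_id, map_measureReal_apply hmap hS,
    map_measureReal_apply hmap hS, EReal.coe_le_coe_iff] at hchain

lemma QuantisedMutualInfoLE.div_le_incTerm (hI : QuantisedMutualInfoLE φ Q I)
    (hφ : ConvexOn ℝ (Ici 0) φ) (hφ1 : φ 1 = 0) (hmono : MonotoneOn φ (Ici 0))
    (hB : MeasurableSet B) (hL : 0 < L) (hBL : (Q.fst.prod Q.snd).real B ≤ L) :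
    ((Q.real B / L : ℝ) : EReal) ≤ incTerm φ I L := by
  have hI0 := hI.nonneg hφ hφ1
  rw [incTerm, conjugate_zero_of_monotoneOn hmono]
  refine le_iInf fun t => le_iInf₂ fun ht hlt => EReal.coe_le_coe_iff.mpr ?_
  have htop : I ≠ ⊤ := fun htop => by
    rw [htop, ← EReal.coe_mul, EReal.top_add_coe,
      EReal.top_div_of_pos_ne_top (EReal.coe_pos.mpr hL) (EReal.coe_ne_top _)] at hlt
    exact not_top_lt hlt
  have hcoe := EReal.coe_toReal htop (ne_bot_of_le_ne_bot EReal.zero_ne_bot hI0)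
  rw [← hcoe, ← EReal.coe_mul, ← EReal.coe_add, ← EReal.coe_div, EReal.coe_lt_coe_iff,
    div_lt_iff₀ hL] at hlt
  rw [div_le_iff₀ hL]
  refine measureReal_le_mul_of_monotoneOn isSetAlgebra_finiteSectionSets
    generateFrom_finiteSectionSets hφ hmono
    (fun A => measureReal_eq_zero_of_mem_finiteSectionSets)
    (fun A => (hcoe.symm ▸ hI).measureReal_mul_sub_le hφ fun t ht => ?_)
    hB hL hBL ht (by linarith)
  simpa only [neg_neg] using hmono (le_refl (0 : ℝ)) ht ht

lemma QuantisedMutualInfoLE.decTerm_le_div (hI : QuantisedMutualInfoLE φ Q I)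
    (hφ : ConvexOn ℝ (Ici 0) φ) (hφ1 : φ 1 = 0) (hanti : AntitoneOn φ (Ici 0))
    (hB : MeasurableSet B) (hL : L < 1) (hBL : (Q.fst.prod Q.snd).real B ≤ L)
    (hLc : 0 < L ∨ conjugate φ 0 ≠ ⊤) :
    decTerm φ I L ≤ ((Q.real Bᶜ / (Q.fst.prod Q.snd).real Bᶜ : ℝ) : EReal) := by
  have hI0 := hI.nonneg hφ hφ1
  have hC := conjugate_zero_nonneg hφ1
  have hBc : 1 - L ≤ (Q.fst.prod Q.snd).real Bᶜ := by
    rw [probReal_compl_eq_one_sub hB]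
    linarith
  have hBc0 : 0 < (Q.fst.prod Q.snd).real Bᶜ := (sub_pos.mpr hL).trans_le hBc
  refine decInverse_le (div_nonneg measureReal_nonneg measureReal_nonneg) fun t ht => ?_
  by_cases htop : I + (L : EReal) * conjugate φ 0 = ⊤
  · rw [htop, EReal.top_div_of_pos_ne_top (EReal.coe_pos.mpr (sub_pos.mpr hL))
      (EReal.coe_ne_top _)]
    exact le_top
  obtain ⟨hItop, hCtop⟩ :=
    ne_top_and_ne_top_of_add_mul_ne_top hI0 hC (measureReal_nonneg.trans hBL) hLc htop
  have hIcoe := EReal.coe_toReal hItop (ne_bot_of_le_ne_bot EReal.zero_ne_bot hI0)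
  have hCcoe := EReal.coe_toReal hCtop (ne_bot_of_le_ne_bot EReal.zero_ne_bot hC)
  have hφC (s : ℝ) (hs : 0 ≤ s) : -(conjugate φ 0).toReal ≤ φ s :=
    neg_le.mp (EReal.coe_le_coe_iff.mp ((neg_coe_le_conjugate_zero φ hs).trans_eq hCcoe.symm))
  have ht0 : 0 ≤ t := (div_nonneg measureReal_nonneg measureReal_nonneg).trans ht.le
  have hbound := (mul_measureReal_le_or_of_antitoneOn isSetAlgebra_finiteSectionSets
    generateFrom_finiteSectionSets hanti (fun A =>
      (hIcoe.symm ▸ hI).measureReal_mul_sub_le hφ hφC) hB.compl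
      ht0).resolve_left ((div_lt_iff₀ hBc0).mp ht).not_ge
  rw [← hIcoe, ← hCcoe, ← EReal.coe_mul, ← EReal.coe_add, ← EReal.coe_div,
    EReal.coe_le_coe_iff, le_div_iff₀ (sub_pos.mpr hL)]
  linarith [mul_le_mul_of_nonneg_right hBc (by linarith [hφC t ht0] :
    0 ≤ φ t + (conjugate φ 0).toReal)]

end Quantised

section Risk

variable {𝓦 𝓥 : Type*} [MeasurableSpace 𝓦] [MeasurableSpace 𝓥] {ℓ : 𝓦 → 𝓥 → ℝ≥0}
  {Q : Measure (𝓦 × 𝓥)} {φ : ℝ → ℝ} {I : EReal} {L ρ : ℝ}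

lemma measurableSet_loss_lt (hℓ : Measurable (Function.uncurry ℓ)) (ρ : ℝ) :
    MeasurableSet {p : 𝓦 × 𝓥 | (ℓ p.1 p.2 : ℝ) < ρ} :=
  measurableSet_lt hℓ.coe_nnreal_real measurable_const

lemma mul_measureReal_compl_le_risk [IsFiniteMeasure Q] (hℓ : Measurable (Function.uncurry ℓ))
    (hρ : 0 < ρ) : ((ρ * Q.real {p | (ℓ p.1 p.2 : ℝ) < ρ}ᶜ : ℝ) : EReal) ≤ risk ℓ Q := by
  have hset : {p : 𝓦 × 𝓥 | (ℓ p.1 p.2 : ℝ) < ρ}ᶜ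
      = {p | ENNReal.ofReal ρ ≤ (ℓ p.1 p.2 : ℝ≥0∞)} := by
    ext p
    simp only [mem_compl_iff, mem_ofPred_eq, not_lt, ENNReal.ofReal_le_coe]
  have hmarkov := mul_meas_ge_le_lintegral (μ := Q) hℓ.coe_nnreal_ennreal (ENNReal.ofReal ρ)
  refine le_trans (le_of_eq ?_) (EReal.coe_ennreal_le_coe_ennreal_iff.mpr hmarkov)
  rw [EReal.coe_ennreal_mul, EReal.coe_ennreal_ofReal, max_eq_left hρ.le, EReal.coe_mul,
    Measure.real, EReal.coe_ennreal_toReal (measure_ne_top _ _), hset]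
  rfl

lemma ballProb_le_smallBallProb_fst [IsProbabilityMeasure Q]
    (hℓ : Measurable (Function.uncurry ℓ)) (ρ : ℝ) :
    ballProb ℓ Q ρ ≤ smallBallProb ℓ Q.fst ρ := by
  have hbdd : BddAbove (range fun v => Q.fst.real {w | (ℓ w v : ℝ) < ρ}) :=
    ⟨1, forall_mem_range.mpr fun _ => measureReal_le_one⟩
  have h0 : 0 ≤ smallBallProb ℓ Q.fst ρ := Real.iSup_nonneg fun _ => measureReal_nonneg
  refine ENNReal.toReal_le_of_le_ofReal h0 ?_
  rw [Measure.prod_apply_symm (measurableSet_loss_lt hℓ ρ)]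
  calc ∫⁻ v, Q.fst ((fun w => (w, v)) ⁻¹' {p | (ℓ p.1 p.2 : ℝ) < ρ}) ∂Q.snd
      ≤ ∫⁻ _, ENNReal.ofReal (smallBallProb ℓ Q.fst ρ) ∂Q.snd :=
        lintegral_mono fun v =>
          (ENNReal.le_ofReal_iff_toReal_le (measure_ne_top _ _) h0).mpr (le_ciSup hbdd v)
    _ = ENNReal.ofReal (smallBallProb ℓ Q.fst ρ) := by simp

variable [IsProbabilityMeasure Q]

lemma QuantisedMutualInfoLE.le_risk_of_monotoneOn (hI : QuantisedMutualInfoLE φ Q I)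
    (hℓ : Measurable (Function.uncurry ℓ)) (hφ : ConvexOn ℝ (Ici 0) φ) (hφ1 : φ 1 = 0)
    (hmono : MonotoneOn φ (Ici 0)) (hρ : 0 < ρ) (hL : 0 < L) (hball : ballProb ℓ Q ρ ≤ L) :
    (ρ : EReal) * (1 - (L : EReal) * incTerm φ I L) ≤ risk ℓ Q := by
  have hB := measurableSet_loss_lt hℓ ρ
  have hquot := hI.div_le_incTerm hφ hφ1 hmono hB hL hball
  calc (ρ : EReal) * (1 - (L : EReal) * incTerm φ I L)
      ≤ ρ * (1 - L * ((Q.real {p | (ℓ p.1 p.2 : ℝ) < ρ} / L : ℝ) : EReal)) :=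
        mul_le_mul_of_nonneg_left
          (EReal.sub_le_sub le_rfl (mul_le_mul_of_nonneg_left hquot (EReal.coe_nonneg.mpr hL.le)))
          (EReal.coe_nonneg.mpr hρ.le)
    _ = ((ρ * Q.real {p | (ℓ p.1 p.2 : ℝ) < ρ}ᶜ : ℝ) : EReal) := by
        rw [probReal_compl_eq_one_sub hB, EReal.coe_mul, EReal.coe_sub, EReal.coe_one,
          ← EReal.coe_mul, mul_div_cancel₀ _ hL.ne']
    _ ≤ risk ℓ Q := mul_measureReal_compl_le_risk hℓ hρ

lemma QuantisedMutualInfoLE.le_risk_of_antitoneOn (hI : QuantisedMutualInfoLE φ Q I)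
    (hℓ : Measurable (Function.uncurry ℓ)) (hφ : ConvexOn ℝ (Ici 0) φ) (hφ1 : φ 1 = 0)
    (hanti : AntitoneOn φ (Ici 0)) (hρ : 0 < ρ) (hL : L < 1) (hball : ballProb ℓ Q ρ ≤ L)
    (hLc : 0 < L ∨ conjugate φ 0 ≠ ⊤) :
    (ρ : EReal) * (1 - (ballProb ℓ Q ρ : EReal)) * decTerm φ I L ≤ risk ℓ Q := by
  have hB := measurableSet_loss_lt hℓ ρ
  have hquot := hI.decTerm_le_div hφ hφ1 hanti hB hL hball hLc
  have hpos : 0 < 1 - ballProb ℓ Q ρ := sub_pos.mpr (hball.trans_lt hL)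
  rw [probReal_compl_eq_one_sub (μ := Q.fst.prod Q.snd) hB] at hquot
  rw [← EReal.coe_one, ← EReal.coe_sub, ← EReal.coe_mul]
  calc ((ρ * (1 - ballProb ℓ Q ρ) : ℝ) : EReal) * decTerm φ I L
      ≤ ((ρ * (1 - ballProb ℓ Q ρ) : ℝ) : EReal)
          * ((Q.real {p | (ℓ p.1 p.2 : ℝ) < ρ}ᶜ / (1 - ballProb ℓ Q ρ) : ℝ) : EReal) :=
        mul_le_mul_of_nonneg_left hquot (EReal.coe_nonneg.mpr (mul_pos hρ hpos).le)
    _ = ((ρ * Q.real {p | (ℓ p.1 p.2 : ℝ) < ρ}ᶜ : ℝ) : EReal) := by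
        rw [← EReal.coe_mul, mul_assoc, mul_div_cancel₀ _ hpos.ne']
    _ ≤ risk ℓ Q := mul_measureReal_compl_le_risk hℓ hρ

end Risk

instance {𝓧 𝓩 : Type*} [MeasurableSpace 𝓧] [MeasurableSpace 𝓩] (K : Kernel 𝓧 𝓩)
    [IsMarkovKernel K] (n : ℕ) : IsMarkovKernel (tensorPower K n) :=
  ⟨fun x => inferInstanceAs (IsProbabilityMeasure (Measure.pi fun i => K (x i)))⟩

end PhiRisk

end

open PhiRisk in
theorem mainTheorem5_general {𝓦 𝓥 𝓧 𝓩 : Type*} [MeasurableSpace 𝓦] [MeasurableSpace 𝓥]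
    [MeasurableSpace 𝓧] [MeasurableSpace 𝓩] (π : Measure 𝓦) [IsProbabilityMeasure π]
    (P : Kernel 𝓦 𝓧) [IsMarkovKernel P] (T : Kernel 𝓧 𝓩) [IsMarkovKernel T]
    (E : Kernel 𝓩 𝓥) [IsMarkovKernel E]
    (ℓ : 𝓦 → 𝓥 → ℝ≥0) (hℓ : Measurable (Function.uncurry ℓ)) (φ : ℝ → ℝ)
    (hφ : ConvexOn ℝ (Ici 0) φ) (hφ1 : φ 1 = 0) :
    (MonotoneOn φ (Ici 0) → ∀ ρ : ℝ, 0 < ρ →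
      (0 < ballProb ℓ (chainLaw π P T E) ρ →
        (ρ : EReal) * (1 - (ballProb ℓ (chainLaw π P T E) ρ : EReal)
            * incTerm φ (contractedMutualInfo φ π P T E) (ballProb ℓ (chainLaw π P T E) ρ))
          ≤ risk ℓ (chainLaw π P T E)) ∧
      (0 < smallBallProb ℓ π ρ →
        (ρ : EReal) * (1 - (smallBallProb ℓ π ρ : EReal)
            * incTerm φ (contractedMutualInfo φ π P T E) (smallBallProb ℓ π ρ))
          ≤ risk ℓ (chainLaw π P T E))) ∧
    (AntitoneOn φ (Ici 0) → ∀ ρ : ℝ, 0 < ρ →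
      (ballProb ℓ (chainLaw π P T E) ρ < 1 →
        (0 < ballProb ℓ (chainLaw π P T E) ρ ∨ conjugate φ 0 ≠ ⊤) →
        (ρ : EReal) * (1 - (ballProb ℓ (chainLaw π P T E) ρ : EReal))
            * decTerm φ (contractedMutualInfo φ π P T E) (ballProb ℓ (chainLaw π P T E) ρ)
          ≤ risk ℓ (chainLaw π P T E)) ∧
      (smallBallProb ℓ π ρ < 1 → (0 < smallBallProb ℓ π ρ ∨ conjugate φ 0 ≠ ⊤) →
        (ρ : EReal) * (1 - (ballProb ℓ (chainLaw π P T E) ρ : EReal))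
            * decTerm φ (contractedMutualInfo φ π P T E) (smallBallProb ℓ π ρ)
          ≤ risk ℓ (chainLaw π P T E))) := by
  have hI : QuantisedMutualInfoLE φ (chainLaw π P T E) (contractedMutualInfo φ π P T E) :=
    quantisedMutualInfoLE_contractedMutualInfo hφ hφ1
  have hball (ρ : ℝ) : ballProb ℓ (chainLaw π P T E) ρ ≤ smallBallProb ℓ π ρ := by
    simpa only [chainLaw, Measure.fst_compProd] using
      ballProb_le_smallBallProb_fst (Q := chainLaw π P T E) hℓ ρ
  exact ⟨fun hmono ρ hρ =>
      ⟨fun hL => hI.le_risk_of_monotoneOn hℓ hφ hφ1 hmono hρ hL le_rfl,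
        fun hL => hI.le_risk_of_monotoneOn hℓ hφ hφ1 hmono hρ hL (hball ρ)⟩,
    fun hanti ρ hρ =>
      ⟨fun hL => hI.le_risk_of_antitoneOn hℓ hφ hφ1 hanti hρ hL le_rfl,
        fun hL => hI.le_risk_of_antitoneOn hℓ hφ hφ1 hanti hρ hL (hball ρ)⟩⟩

theorem mainTheorem5 {𝓦 𝓥 𝓧 𝓩 : Type*} [MeasurableSpace 𝓦] [MeasurableSpace 𝓥]
    [MeasurableSpace 𝓧] [MeasurableSpace 𝓩] (n : ℕ)
    (π : Measure 𝓦) [IsProbabilityMeasure π]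
    (P : Kernel 𝓦 (Fin n → 𝓧)) [IsMarkovKernel P]
    (K : Kernel 𝓧 𝓩) [IsMarkovKernel K]
    (E : Kernel (Fin n → 𝓩) 𝓥) [IsMarkovKernel E]
    (ℓ : 𝓦 → 𝓥 → ℝ≥0) (hℓ : Measurable (Function.uncurry ℓ))
    (φ : ℝ → ℝ) (hφ : ConvexOn ℝ (Ici 0) φ) (hφ1 : φ 1 = 0) :
    (MonotoneOn φ (Ici 0) →
      MonotoneOn (fun p : ℝ × ℝ => PhiRisk.G φ p.1 p.2) (Ici 0 ×ˢ Ioc 0 1) →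
      ∀ ρ : ℝ, 0 < ρ →
        (0 < PhiRisk.ballProb ℓ (PhiRisk.jointWEst π P K E) ρ →
          (ρ : EReal) * (1 - (PhiRisk.ballProb ℓ (PhiRisk.jointWEst π P K E) ρ : EReal)
              * PhiRisk.incTerm φ (PhiRisk.contractedInfo φ π P K E)
                  (PhiRisk.ballProb ℓ (PhiRisk.jointWEst π P K E) ρ))
            ≤ (PhiRisk.risk ℓ (PhiRisk.jointWEst π P K E) : EReal)) ∧
        (0 < PhiRisk.smallBallProb ℓ π ρ →
          (ρ : EReal) * (1 - (PhiRisk.smallBallProb ℓ π ρ : EReal)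
              * PhiRisk.incTerm φ (PhiRisk.contractedInfo φ π P K E)
                  (PhiRisk.smallBallProb ℓ π ρ))
            ≤ (PhiRisk.risk ℓ (PhiRisk.jointWEst π P K E) : EReal))) ∧
    (AntitoneOn φ (Ici 0) →
      ∀ ρ : ℝ, 0 < ρ →
        (PhiRisk.ballProb ℓ (PhiRisk.jointWEst π P K E) ρ < 1 →
          (0 < PhiRisk.ballProb ℓ (PhiRisk.jointWEst π P K E) ρ ∨ PhiRisk.conjugate φ 0 ≠ ⊤) →
          (ρ : EReal) * (1 - (PhiRisk.ballProb ℓ (PhiRisk.jointWEst π P K E) ρ : EReal))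
              * PhiRisk.decTerm φ (PhiRisk.contractedInfo φ π P K E)
                  (PhiRisk.ballProb ℓ (PhiRisk.jointWEst π P K E) ρ)
            ≤ (PhiRisk.risk ℓ (PhiRisk.jointWEst π P K E) : EReal)) ∧
        (PhiRisk.smallBallProb ℓ π ρ < 1 →
          (0 < PhiRisk.smallBallProb ℓ π ρ ∨ PhiRisk.conjugate φ 0 ≠ ⊤) →
          (ρ : EReal) * (1 - (PhiRisk.ballProb ℓ (PhiRisk.jointWEst π P K E) ρ : EReal))
              * PhiRisk.decTerm φ (PhiRisk.contractedInfo φ π P K E)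
                  (PhiRisk.smallBallProb ℓ π ρ)
            ≤ (PhiRisk.risk ℓ (PhiRisk.jointWEst π P K E) : EReal))) := by
  have h := mainTheorem5_general π P (PhiRisk.tensorPower K n) E ℓ hℓ φ hφ hφ1
  exact ⟨fun hmono _ => h.1 hmono, h.2⟩
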